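/- For $N\ge 0$ let $\Omega=\bigoplus_{j=1}^N\begin{pmatrix}0&1\\-1&0\end{pmatrix}$, let $Q_j,P_j$ be the canonical position and momentum operators on $\mathcal H_N=L^2(\mathbb R^N)$, $R=(Q_1,P_1,\dots,Q_N,P_N)^T$, and let $W(x)=e^{-ix^T\Omega R}$, $x\in\mathbb R^{2N}$, be the Weyl operators; explicitly, for $x=(q_1,p_1,\dots,q_N,p_N)$, $(W(x)\psi)(t)=e^{i(p\cdot t-p\cdot q/2)}\psi(t-q)$. The same notation $\Omega$, $W$ is used for different numbers of degrees of freedom. An inequality $X\ge 0$ for a complex square matrix means that $X$ is Hermitian positive semidefinite. A quantum channel (in the Heisenberg picture) $\Lambda:\mathcal L(\mathcal H_{N'})\to\mathcal L(\mathcal H_N)$ is a completely positive, unital, normal (weak-* continuous) linear map. It is the Gaussian channel $\Lambda_{(A,B,c)}$, with $A\in\mathbb R^{2N\times 2N'}$, $B\in\mathbb R^{2N'\times 2N'}$, $c\in\mathbb R^{2N'}$, if $B+i\Omega-iA^T\Omega A\ge 0$ and $$\Lambda(W(x))=W(Ax)\,e^{-\frac14x^TBx-ic^Tx}\qquad\text{for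 all }x\in\mathbb R^{2N'}.$$ An observable on $\mathbb R^M$ is a normalised positive operator valued measure $E:\mathcal B(\mathbb R^M)\to\mathcal L(\mathcal H_N)$. It is Gaussian if there are $K\in\mathbb R^{2N\times M}$, $L\in\mathbb R^{M\times M}$, $m\in\mathbb R^M$ with $L-iK^T\Omega K\ge0$ and $$\int e^{ip^Tx}\,dE(x)=W(Kp)\,e^{-\frac14p^TLp-im^Tp}\qquad\text{for all }p\in\mathbb R^M.$$ A Gaussian postprocessing from $\mathbb R^{M}$ to $\mathbb R^{M'}$ is a Markov kernel $f$ such that, for some $a\in\mathbb R^{M\times M'}$, some positive semidefinite $b\in\mathbb R^{M'\times M'}$ and some $d\in\mathbb R^{M'}$, $$\int e^{ip^Ty}f(dy,x)=e^{i(ap)^Tx}e^{-\frac14p^Tbp-id^Tp}\qquad\text{for all }x\in\mathbb R^M,\ p\in\mathbb R^{M'}.$$ A collection $\mathcal M$ of Gaussian observables on $\mathcal H_N$ (with possibly different outcome spaces) is Gaussian compatible if there is a Gaussian observable $G$ on $\mathcal H_N$ such that every $E\in\mathcal M$ has the form $E(X)=\int f_E(X,x)\,dG(x)$ for all Borel sets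 $X$, with a Gaussian postprocessing $f_E$. A Gaussian channel $\Lambda$ is Gaussian incompatibility breaking if the set $\{\Lambda\circ E: E\text{ a Gaussian observable on }\mathcal H_{N'}\}$ is Gaussian compatible. **Proposition.** A Gaussian channel $\Lambda_{(A,B,c)}$ is Gaussian incompatibility breaking if and only if $$B-iA^T\Omega A\ge 0.$$ -/

import Mathlib

open MeasureTheory Filter Topology ProbabilityTheory
open scoped Matrix CStarAlgebra ComplexOrder ENNReal

noncomputable section

namespace GaussianIB

section Abstract

/-! ### Positive operator valued measures -/

/-- A positive operator valued measure (observable) on the measurable space `Ω` with values in the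
bounded operators on `H`. The σ-additivity is in the weak operator topology; the value on
non-measurable sets is fixed to be `0`, as for Mathlib's `VectorMeasure`. -/
structure POVM (Ω : Type*) [MeasurableSpace Ω] (H : Type*) [NormedAddCommGroup H]
    [InnerProductSpace ℂ H] where
  /-- The operator `E(X)`. -/
  effect : Set Ω → H →L[ℂ] H
  isPositive : ∀ X, MeasurableSet X → (effect X).IsPositive
  effect_univ : effect Set.univ = 1
  hasSum_iUnion : ∀ X : ℕ → Set Ω, (∀ i, MeasurableSet (X i)) →
    Pairwise (Function.onFun Disjoint X) →
    ∀ φ ψ : H, HasSum (fun i => inner ℂ φ (effect (X i) ψ)) (inner ℂ φ (effect (⋃ i, X i) ψ))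
  not_measurable : ∀ X, ¬ MeasurableSet X → effect X = 0

variable {Ω : Type*} [MeasurableSpace Ω] {H : Type*} [NormedAddCommGroup H]
  [InnerProductSpace ℂ H]

theorem POVM.effect_empty (E : POVM Ω H) : E.effect ∅ = 0 := by
  ext ψ
  refine ext_inner_left ℂ fun φ => ?_
  have h := E.hasSum_iUnion (fun _ => ∅) (fun _ => MeasurableSet.empty)
    (fun _ _ _ => disjoint_bot_left) φ ψ
  simpa using h.summable.tendsto_atTop_zero

theorem POVM.inner_eq_re (E : POVM Ω H) {X : Set Ω} (hX : MeasurableSet X) (ψ : H) :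
    inner ℂ ψ (E.effect X ψ) = ((inner ℂ ψ (E.effect X ψ)).re : ℂ) ∧
      0 ≤ (inner ℂ ψ (E.effect X ψ)).re := by
  have h := (E.isPositive X hX).inner_nonneg_right ψ
  rw [Complex.le_def] at h
  exact ⟨Complex.ext (by simp) (by simpa using h.2.symm), by simpa using h.1⟩

/-- The finite measure `X ↦ ⟨ψ, E(X) ψ⟩`; for a unit vector `ψ` this is the probability
distribution of the outcomes of `E` in the pure state `ψ`. -/
def POVM.measure (E : POVM Ω H) (ψ : H) : Measure Ω :=
  Measure.ofMeasurable (fun X _ => ENNReal.ofReal (inner ℂ ψ (E.effect X ψ)).re)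
    (by simp [E.effect_empty])
    (by
      intro X hX hd
      have h := (Complex.hasSum_re (E.hasSum_iUnion X hX hd ψ ψ))
      rw [← h.tsum_eq]
      exact ENNReal.ofReal_tsum_of_nonneg (fun i => (E.inner_eq_re (hX i) ψ).2) h.summable)

theorem POVM.measure_apply (E : POVM Ω H) (ψ : H) {X : Set Ω} (hX : MeasurableSet X) :
    E.measure ψ X = ENNReal.ofReal (inner ℂ ψ (E.effect X ψ)).re :=
  Measure.ofMeasurable_apply X hX

/-- `E.IsIntegral f T` says that `∫ f dE = T` in the weak sense. As `H` is a complex space, the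
operator `T` is determined by its quadratic form. -/
def POVM.IsIntegral (E : POVM Ω H) (f : Ω → ℂ) (T : H →L[ℂ] H) : Prop :=
  ∀ ψ : H, Integrable f (E.measure ψ) ∧ ∫ x, f x ∂(E.measure ψ) = inner ℂ ψ (T ψ)

/-- `E` is obtained from the observable `G` by postprocessing with the kernel `f`, that is,
`E(X) = ∫ f(X, x) dG(x)` for all measurable `X`. -/
def IsPostprocessing {Ω' : Type*} [MeasurableSpace Ω'] (f : Kernel Ω Ω') (G : POVM Ω H)
    (E : POVM Ω' H) : Prop :=
  ∀ X : Set Ω', MeasurableSet X → G.IsIntegral (fun x => (((f x).real X : ℝ) : ℂ)) (E.effect X)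

/-! ### Quantum channels in the Heisenberg picture -/

/-- Pairs of square-summable sequences of vectors. They describe the normal functionals
`T ↦ ∑ n, ⟨ξ n, T (η n)⟩ = tr (ρ T)`, where `ρ = ∑ n, |η n⟩⟨ξ n|` runs through all trace class
operators. -/
def SqSummablePair (H : Type*) [NormedAddCommGroup H] : Type _ :=
  {p : (ℕ → H) × (ℕ → H) // Summable (fun n => ‖p.1 n‖ ^ 2) ∧ Summable (fun n => ‖p.2 n‖ ^ 2)}

/-- The value `tr (ρ T) = ∑ n, ⟨ξ n, T (η n)⟩`. The series converges absolutely. -/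
def SqSummablePair.eval (p : SqSummablePair H) (T : H →L[ℂ] H) : ℂ :=
  ∑' n, inner ℂ (p.1.1 n) (T (p.1.2 n))

/-- The weak-* (ultraweak) topology of the bounded operators on `H`: the coarsest topology that
makes all functionals `T ↦ tr (ρ T)` with `ρ` of trace class continuous. -/
@[reducible] def ultraweak (H : Type*) [NormedAddCommGroup H] [InnerProductSpace ℂ H] :
    TopologicalSpace (H →L[ℂ] H) :=
  ⨅ p : SqSummablePair H, TopologicalSpace.induced p.eval inferInstance

theorem tendsto_ultraweak {ι : Type*} {l : Filter ι} {u : ι → H →L[ℂ] H} {T : H →L[ℂ] H} :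
    Tendsto u l (@nhds _ (ultraweak H) T) ↔
      ∀ p : SqSummablePair H, Tendsto (fun i => p.eval (u i)) l (𝓝 (p.eval T)) := by
  rw [ultraweak, nhds_iInf, tendsto_iInf]
  refine forall_congr' fun p => ?_
  rw [nhds_induced, tendsto_comap_iff]
  rfl

theorem SqSummablePair.summable_norm {H : Type*} [NormedAddCommGroup H] (p : SqSummablePair H) :
    Summable (fun n => ‖p.1.1 n‖ * ‖p.1.2 n‖) := by
  refine Summable.of_nonneg_of_le (fun n => by positivity) (fun n => ?_) (p.2.1.add p.2.2)
  nlinarith [sq_nonneg (‖p.1.1 n‖ - ‖p.1.2 n‖), sq_nonneg (‖p.1.1 n‖), sq_nonneg (‖p.1.2 n‖)]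

theorem tendsto_ultraweak_of_bounded {ι : Type*} {l : Filter ι} {u : ι → H →L[ℂ] H}
    {T : H →L[ℂ] H} (C : ℝ) (hC : ∀ i, ‖u i‖ ≤ C)
    (h : ∀ φ ψ : H, Tendsto (fun i => inner ℂ φ (u i ψ)) l (𝓝 (inner ℂ φ (T ψ)))) :
    Tendsto u l (@nhds _ (ultraweak H) T) := by
  rw [tendsto_ultraweak]
  intro p
  refine tendsto_tsum_of_dominated_convergence (p.summable_norm.mul_left C) (fun n => h _ _)
    (Eventually.of_forall fun i n => ?_)
  refine (norm_inner_le_norm _ _).trans ?_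
  have h1 := ((u i).le_opNorm (p.1.2 n)).trans
    (mul_le_mul_of_nonneg_right (hC i) (norm_nonneg _))
  nlinarith [norm_nonneg (p.1.1 n)]

/-- The pair of sequences that describes the functional `T ↦ ⟨φ, T ψ⟩`. -/
def SqSummablePair.single (φ ψ : H) : SqSummablePair H :=
  ⟨(Pi.single 0 φ, Pi.single 0 ψ),
    summable_of_ne_finset_zero (s := {0}) (by intro n hn; simp at hn; simp [hn]),
    summable_of_ne_finset_zero (s := {0}) (by intro n hn; simp at hn; simp [hn])⟩

theorem SqSummablePair.single_eval (φ ψ : H) (T : H →L[ℂ] H) :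
    (SqSummablePair.single φ ψ).eval T = inner ℂ φ (T ψ) := by
  rw [SqSummablePair.eval, tsum_eq_single 0]
  · simp [SqSummablePair.single]
  · intro n hn
    simp [SqSummablePair.single, hn]

/-- A quantum channel in the Heisenberg picture: a completely positive, unital and normal
(weak-* continuous) linear map from the bounded operators on the output space `H'` to the bounded
operators on the input space `H`. -/
structure QuantumChannel (H' H : Type*) [NormedAddCommGroup H'] [InnerProductSpace ℂ H']
    [CompleteSpace H'] [NormedAddCommGroup H] [InnerProductSpace ℂ H] [CompleteSpace H] where
  /-- The underlying completely positive map. -/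
  toCP : (H' →L[ℂ] H') →CP (H →L[ℂ] H)
  map_one : toCP 1 = 1
  normal : @Continuous _ _ (ultraweak H') (ultraweak H) toCP

theorem POVM.norm_sum_le [CompleteSpace H] (E : POVM Ω H) (X : ℕ → Set Ω)
    (hX : ∀ i, MeasurableSet (X i)) (hd : Pairwise (Function.onFun Disjoint X)) (s : Finset ℕ) :
    ‖∑ i ∈ s, E.effect (X i)‖ ≤ 1 := by
  have h0 : (∑ i ∈ s, E.effect (X i)).IsPositive :=
    (ContinuousLinearMap.nonneg_iff_isPositive _).1 (Finset.sum_nonneg fun i _ =>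
      (ContinuousLinearMap.nonneg_iff_isPositive _).2 (E.isPositive _ (hX i)))
  rw [CStarAlgebra.norm_le_one_iff_of_nonneg _
    ((ContinuousLinearMap.nonneg_iff_isPositive _).2 h0), ContinuousLinearMap.le_def]
  refine (ContinuousLinearMap.isPositive_def).2
    ⟨(ContinuousLinearMap.isPositive_one.isSymmetric).sub h0.isSymmetric, fun ψ => ?_⟩
  have h1 : ∑ i ∈ s, E.measure ψ (X i) ≤ E.measure ψ Set.univ := by
    rw [← measure_biUnion_finset (fun i _ j _ hij => hd hij) (fun i _ => hX i)]
    exact measure_mono (Set.subset_univ _)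
  simp only [E.measure_apply ψ (hX _), E.measure_apply ψ MeasurableSet.univ] at h1
  rw [← ENNReal.ofReal_sum_of_nonneg (fun i _ => (E.inner_eq_re (hX i) ψ).2),
    ENNReal.ofReal_le_ofReal_iff (E.inner_eq_re MeasurableSet.univ ψ).2, E.effect_univ] at h1
  have h2 : (inner ℂ ψ ((∑ i ∈ s, E.effect (X i)) ψ)).re
      = ∑ i ∈ s, (inner ℂ ψ (E.effect (X i) ψ)).re := by
    rw [_root_.sum_apply, inner_sum, Complex.re_sum]
  rw [ContinuousLinearMap.reApplyInnerSelf_apply, inner_re_symm]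
  simp only [_root_.sub_apply, inner_sub_right, map_sub, RCLike.re_to_complex]
  rw [h2]
  linarith

/-- The observable `X ↦ Λ(E(X))`, the image of `E` under the channel `Λ`. -/
def QuantumChannel.map {H' : Type*} [NormedAddCommGroup H'] [InnerProductSpace ℂ H']
    [CompleteSpace H'] [CompleteSpace H] (Λ : QuantumChannel H' H) (E : POVM Ω H') : POVM Ω H where
  effect X := Λ.toCP (E.effect X)
  isPositive X hX := by
    rw [← ContinuousLinearMap.nonneg_iff_isPositive]
    have h := (ContinuousLinearMap.nonneg_iff_isPositive _).2 (E.isPositive X hX)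
    exact map_nonneg Λ.toCP h
  effect_univ := by rw [E.effect_univ, Λ.map_one]
  hasSum_iUnion X hX hd φ ψ := by
    have h1 : Tendsto (fun s : Finset ℕ => ∑ i ∈ s, E.effect (X i)) atTop
        (@nhds _ (ultraweak H') (E.effect (⋃ i, X i))) := by
      refine tendsto_ultraweak_of_bounded 1 (E.norm_sum_le X hX hd) fun φ ψ => ?_
      simpa [HasSum, _root_.sum_apply, inner_sum] using E.hasSum_iUnion X hX hd φ ψ
    have h2 := tendsto_ultraweak.1
      ((@Continuous.tendsto _ _ (ultraweak H') (ultraweak H) _ Λ.normal _).comp h1)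
      (SqSummablePair.single φ ψ)
    simpa [HasSum, SqSummablePair.single_eval, _root_.sum_apply, inner_sum,
      map_sum] using h2
  not_measurable X hX := by rw [E.not_measurable X hX, map_zero]

end Abstract

/-! ### Continuous variable systems -/

/-- The index set of the `2N` phase space coordinates: `(0, j)` is the index of `q_j` and `(1, j)`
is the index of `p_j`. -/
abbrev PhaseIdx (N : ℕ) : Type := Fin 2 × Fin N

/-- The symplectic matrix, the direct sum of `N` copies of the `2 × 2` matrix with rows `(0, 1)`
and `(-1, 0)`. -/
def symplectic (N : ℕ) : Matrix (PhaseIdx N) (PhaseIdx N) ℝ :=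
  Matrix.blockDiagonal fun _ : Fin N => !![0, 1; -1, 0]

/-- The Hilbert space `L²(ℝ^N)` of a system with `2N` canonical degrees of freedom. -/
abbrev Hilb (N : ℕ) : Type := Lp ℂ 2 (volume : Measure (Fin N → ℝ))

/-- The function `t ↦ e^{i (p·t - p·q/2)} ψ(t - q)` where `x = (q, p)`. This is
`e^{-i xᵀΩR} ψ = e^{i ∑ j, (p_j Q_j - q_j P_j)} ψ`, with `(Q_j ψ)(t) = t_j ψ(t)` and
`P_j = -i ∂_j`. -/
def weylFun {N : ℕ} (x : PhaseIdx N → ℝ) (ψ : (Fin N → ℝ) → ℂ) (t : Fin N → ℝ) : ℂ :=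
  Complex.exp (Complex.I * (((∑ j, x (1, j) * t j) - (∑ j, x (1, j) * x (0, j)) / 2 : ℝ) : ℂ)) *
    ψ (t - fun j => x (0, j))

theorem norm_weylFun {N : ℕ} (x : PhaseIdx N → ℝ) (ψ : (Fin N → ℝ) → ℂ) (t : Fin N → ℝ) :
    ‖weylFun x ψ t‖ = ‖ψ (t - fun j => x (0, j))‖ := by
  rw [weylFun, norm_mul, mul_comm Complex.I, Complex.norm_exp_ofReal_mul_I, one_mul]

theorem memLp_weylFun {N : ℕ} (x : PhaseIdx N → ℝ) {ψ : (Fin N → ℝ) → ℂ}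
    (h : MemLp ψ 2 volume) : MemLp (weylFun x ψ) 2 volume := by
  have h1 := h.comp_measurePreserving
    (measurePreserving_sub_right (volume : Measure (Fin N → ℝ)) (fun j => x (0, j)))
  refine h1.of_le ?_ (Eventually.of_forall fun t => (norm_weylFun x ψ t).le)
  refine AEStronglyMeasurable.mul (Continuous.aestronglyMeasurable (by fun_prop)) h1.1

theorem weylFun_congr {N : ℕ} (x : PhaseIdx N → ℝ) {ψ φ : (Fin N → ℝ) → ℂ}
    (h : ψ =ᵐ[volume] φ) : weylFun x ψ =ᵐ[volume] weylFun x φ := by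
  have h1 := (measurePreserving_sub_right (volume : Measure (Fin N → ℝ))
    (fun j => x (0, j))).quasiMeasurePreserving.ae_eq_comp h
  filter_upwards [h1] with t ht
  simp only [Function.comp_apply] at ht
  simp [weylFun, ht]

/-- The Weyl operator `W(x) = e^{-i xᵀΩR}` on `L²(ℝ^N)`. -/
def weyl {N : ℕ} (x : PhaseIdx N → ℝ) : Hilb N →L[ℂ] Hilb N :=
  LinearIsometry.toContinuousLinearMap
    { toFun := fun ψ => (memLp_weylFun x (Lp.memLp ψ)).toLp
      map_add' := by
        intro ψ φ
        rw [← MemLp.toLp_add]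
        refine (MemLp.toLp_eq_toLp_iff _ _).2 ?_
        refine (weylFun_congr x (Lp.coeFn_add ψ φ)).trans (Eventually.of_forall fun t => ?_)
        simp [weylFun, mul_add]
      map_smul' := by
        intro c ψ
        rw [RingHom.id_apply, ← MemLp.toLp_const_smul]
        refine (MemLp.toLp_eq_toLp_iff _ _).2 ?_
        refine (weylFun_congr x (Lp.coeFn_smul c ψ)).trans (Eventually.of_forall fun t => ?_)
        simp [weylFun, mul_left_comm]
      norm_map' := by
        intro ψ
        change ‖(memLp_weylFun x (Lp.memLp ψ)).toLp‖ = ‖ψ‖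
        rw [Lp.norm_toLp, Lp.norm_def]
        congr 1
        rw [← eLpNorm_comp_measurePreserving (Lp.aestronglyMeasurable ψ)
          (measurePreserving_sub_right (volume : Measure (Fin N → ℝ)) (fun j => x (0, j)))]
        exact eLpNorm_congr_norm_ae (Eventually.of_forall fun t => norm_weylFun x ψ t) }

theorem weyl_coeFn {N : ℕ} (x : PhaseIdx N → ℝ) (ψ : Hilb N) :
    weyl x ψ =ᵐ[volume] weylFun x ψ :=
  MemLp.coeFn_toLp (memLp_weylFun x (Lp.memLp ψ))

/-! ### Gaussian observables, channels and postprocessings -/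

/-- `B - i AᵀΩA` as a complex matrix. -/
def noiseMatrix {N : ℕ} {ι : Type*} (A : Matrix (PhaseIdx N) ι ℝ) (B : Matrix ι ι ℝ) :
    Matrix ι ι ℂ :=
  B.map Complex.ofReal - Complex.I • (Aᵀ * symplectic N * A).map Complex.ofReal

/-- The Gaussian factor `e^{-pᵀLp/4 - i mᵀp}`. -/
def gaussFactor {ι : Type*} [Fintype ι] (L : Matrix ι ι ℝ) (m p : ι → ℝ) : ℂ :=
  Complex.exp (-(1 / 4) * ((p ⬝ᵥ L *ᵥ p : ℝ) : ℂ) - Complex.I * ((m ⬝ᵥ p : ℝ) : ℂ))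

/-- The character `x ↦ e^{i pᵀx}` of `ℝ^M`. -/
def character {M : ℕ} (p : Fin M → ℝ) (x : EuclideanSpace ℝ (Fin M)) : ℂ :=
  Complex.exp (Complex.I * ((∑ j, p j * x j : ℝ) : ℂ))

/-- Observables of the system on `L²(ℝ^N)` with outcome space `ℝ^M`. -/
abbrev Observable (M N : ℕ) : Type := POVM (EuclideanSpace ℝ (Fin M)) (Hilb N)

/-- `E` is the Gaussian observable with parameters `(K, L, m)`: one has `L - i KᵀΩK ≥ 0` and
`∫ e^{i pᵀx} dE(x) = e^{-pᵀLp/4 - i mᵀp} W(Kp)` for all `p`. -/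
def HasGaussianParams {M N : ℕ} (E : Observable M N) (K : Matrix (PhaseIdx N) (Fin M) ℝ)
    (L : Matrix (Fin M) (Fin M) ℝ) (m : Fin M → ℝ) : Prop :=
  (noiseMatrix K L).PosSemidef ∧
    ∀ p : Fin M → ℝ, E.IsIntegral (character p) (gaussFactor L m p • weyl (K *ᵥ p))

/-- Gaussian observables. -/
def IsGaussianObservable {M N : ℕ} (E : Observable M N) : Prop :=
  ∃ K L m, HasGaussianParams E K L m

/-- `Λ` is the Gaussian channel `Λ_(A,B,c)`: one has `B + iΩ - i AᵀΩA ≥ 0` and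
`Λ(W(x)) = e^{-xᵀBx/4 - i cᵀx} W(Ax)` for all `x`. -/
def IsGaussianChannel {N' N : ℕ} (Λ : QuantumChannel (Hilb N') (Hilb N))
    (A : Matrix (PhaseIdx N) (PhaseIdx N') ℝ) (B : Matrix (PhaseIdx N') (PhaseIdx N') ℝ)
    (c : PhaseIdx N' → ℝ) : Prop :=
  (noiseMatrix A B + Complex.I • (symplectic N').map Complex.ofReal).PosSemidef ∧
    ∀ x : PhaseIdx N' → ℝ, Λ.toCP (weyl x) = gaussFactor B c x • weyl (A *ᵥ x)

/-- `f` is a Gaussian postprocessing (a classical Gaussian channel): a Markov kernel with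
`∫ e^{i pᵀy} f(dy, x) = e^{i (Ap)ᵀx} e^{-pᵀBp/4 - i cᵀp}` for some matrix `A`, some positive
semidefinite matrix `B` and some vector `c`. -/
def IsGaussianKernel {M M' : ℕ}
    (f : Kernel (EuclideanSpace ℝ (Fin M)) (EuclideanSpace ℝ (Fin M'))) : Prop :=
  IsMarkovKernel f ∧ ∃ (A : Matrix (Fin M) (Fin M') ℝ) (B : Matrix (Fin M') (Fin M') ℝ)
    (c : Fin M' → ℝ), B.PosSemidef ∧ ∀ (p : Fin M' → ℝ) (x : EuclideanSpace ℝ (Fin M)),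
      ∫ y, character p y ∂(f x) = character (A *ᵥ p) x * gaussFactor B c p

/-- A collection of observables of one system, whose outcome spaces `ℝ^M` may differ, is Gaussian
compatible if all of them are obtained from a single Gaussian observable by Gaussian
postprocessings. -/
def GaussianCompatible {N : ℕ} (𝓜 : Set (Σ M : ℕ, Observable M N)) : Prop :=
  ∃ (M₀ : ℕ) (G : Observable M₀ N), IsGaussianObservable G ∧
    ∀ E ∈ 𝓜, ∃ f : Kernel (EuclideanSpace ℝ (Fin M₀)) (EuclideanSpace ℝ (Fin E.1)),
      IsGaussianKernel f ∧ IsPostprocessing f G E.2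

/-- `Λ` breaks the Gaussian incompatibility of `𝓜`: the set `Λ(𝓜)` is Gaussian compatible. -/
def BreaksGaussianIncompatibility {N' N : ℕ} (Λ : QuantumChannel (Hilb N') (Hilb N))
    (𝓜 : Set (Σ M : ℕ, Observable M N')) : Prop :=
  GaussianCompatible ((fun E => (⟨E.1, Λ.map E.2⟩ : Σ M : ℕ, Observable M N)) '' 𝓜)

/-- `Λ` is Gaussian incompatibility breaking: it breaks the Gaussian incompatibility of the set of
all Gaussian observables. -/
def IsGaussianIncompatibilityBreaking {N' N : ℕ}
    (Λ : QuantumChannel (Hilb N') (Hilb N)) : Prop :=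
  BreaksGaussianIncompatibility Λ {E | IsGaussianObservable E.2}

end GaussianIB

end

/-!
In terms of characteristic functions, an image `Λ ∘ E` is a Gaussian postprocessing of `G` exactly
if the phase space points and the Gaussian factors in front of the Weyl operators match. Both
implications compare these data with suitable Gaussian observables, so that the analytic core is
the existence of such observables. Only those with parameters `(K, L, m)` for *positive definite*
`L` are needed (`exists_hasGaussianParams`), and these have a density: the matrix elements
`F(p) = e^{-pᵀLp/4 - i mᵀp} ⟨ψ, W(Kp) ψ⟩` are integrable. By the Weyl relations,
`F(q - p)` is the product of a rank one kernel, a Gram kernel and the kernel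
`exp (pᵀ(L - i KᵀΩK)q / 2)`; hence `L - i KᵀΩK ≥ 0` and Schur's product theorem make `F` positive
definite (`posSemidef_charForm`). The Fourier transform of a continuous, integrable, positive
definite function is nonnegative (`fourier_nonneg_of_posDef`) and integrable
(`integrable_fourier_of_posDef`), so that Fourier inversion exhibits it as the density sought.

If `B - i AᵀΩA ≥ 0`, then the condition `B + iΩ - i AᵀΩA ≥ 0` forces `B` to be positive definite,
since a real null vector of `B` is annihilated by both matrices and therefore by the invertible
matrix `Ω` (`posDef_of_posSemidef_noiseMatrix`). So there is a Gaussian observable `G` with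
parameters `(A, B, c)`, and the image of the observable with parameters `(K, L, m)` is obtained
from `G` by the linear map `Kᵀ` followed by Gaussian noise.

Conversely, let all images be postprocessings of `G`, with parameters `(K₀, L₀, m₀)`. Applied to
the quadrature in direction `u`, blurred by noise of size `ε`, this gives a vector `s` with
`A u = K₀ s` and `sᵀL₀s ≤ uᵀBu + ε` (`exists_le_of_isPostprocessing`). The matrix inequality for `G`
is equivalent to the uncertainty relation `0 ≤ sᵀL₀s + tᵀL₀t + 2 (K₀s)ᵀΩ(K₀t)`
(`posSemidef_noiseMatrix_iff`), so with `ε → 0` it yields the corresponding relation for `(A, B)`.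
The vector `s` need not depend linearly on `u`.
-/

namespace GaussianIB

/-! ### Positive semidefinite kernels -/

section Kernels

theorem posSemidef_of_tendsto {ι : Type*} {u : ℕ → Matrix ι ι ℂ} {T : Matrix ι ι ℂ}
    (hu : ∀ n, (u n).PosSemidef) (h : ∀ i j, Tendsto (fun n => u n i j) atTop (𝓝 (T i j))) :
    T.PosSemidef := by
  refine ⟨?_, fun x => ?_⟩
  · ext i j
    refine tendsto_nhds_unique ?_ (h i j)
    have := (Complex.continuous_conj.tendsto _).comp (h j i)
    refine this.congr fun n => ?_
    exact congrFun (congrFun (hu n).1 i) j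
  · refine ge_of_tendsto' (x := atTop) (f := fun n => x.sum fun i xi => x.sum fun j xj =>
      star xi * u n i j * xj) ?_ fun n => (hu n).2 x
    refine tendsto_finsetSum _ fun i _ => tendsto_finsetSum _ fun j _ => ?_
    exact ((h i j).const_mul _).mul_const _

theorem posSemidef_map_pow {ι : Type*} {T : Matrix ι ι ℂ} (hT : T.PosSemidef) (n : ℕ) :
    (T.map (· ^ n)).PosSemidef := by
  induction n with
  | zero =>
    refine ⟨by ext i j; simp, fun x => ?_⟩
    have : (x.sum fun i xi => x.sum fun j xj => star xi * (T.map (· ^ 0)) i j * xj)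
        = star (x.sum fun _ xi => xi) * x.sum fun _ xi => xi := by
      simp only [Finsupp.sum, Matrix.map_apply, pow_zero, mul_one, star_sum, Finset.sum_mul_sum]
    rw [this]
    exact star_mul_self_nonneg _
  | succ n ih =>
    have h : T.map (· ^ (n + 1)) = (T.map (· ^ n)) ⊙ T := by
      ext i j
      simp [pow_succ]
    rw [h]
    exact ih.hadamard hT

/-- The entrywise exponential of a positive semidefinite kernel is positive semidefinite: the
powers are by Schur's product theorem, and the exponential series has nonnegative coefficients. -/
theorem posSemidef_map_exp {ι : Type*} {T : Matrix ι ι ℂ} (hT : T.PosSemidef) :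
    (T.map Complex.exp).PosSemidef := by
  refine posSemidef_of_tendsto (u := fun n => ∑ k ∈ Finset.range n,
    ((Nat.factorial k : ℂ)⁻¹) • T.map (· ^ k)) (fun n => ?_) fun i j => ?_
  · refine Matrix.posSemidef_sum _ fun k _ => (posSemidef_map_pow hT k).smul ?_
    exact inv_nonneg.2 (Nat.cast_nonneg _)
  · have h := (NormedSpace.expSeries_div_hasSum_exp (T i j)).tendsto_sum_nat
    rw [← Complex.exp_eq_exp_ℂ] at h
    refine h.congr fun n => ?_
    simp only [Matrix.sum_apply, Matrix.smul_apply, Matrix.map_apply, smul_eq_mul]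
    exact Finset.sum_congr rfl fun k _ => by rw [div_eq_inv_mul]

theorem sum_sum_nonneg_of_posSemidef {ι : Type*} {T : Matrix ι ι ℂ} (hT : T.PosSemidef) {n : ℕ}
    (x : Fin n → ι) : 0 ≤ ∑ i, ∑ j, T (x i) (x j) := by
  have h := (Matrix.posSemidef_iff_dotProduct_mulVec.1 (hT.submatrix x)).2 1
  simpa [dotProduct, Matrix.mulVec] using h

/-- The average of a bounded positive semidefinite kernel over two independent points of a
probability space is nonnegative. This is read off from the average of
`∑ i j, k (x i) (x j) ≥ 0` over `n` independent points, whose off-diagonal terms dominate as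
`n → ∞`. -/
theorem integral_prod_nonneg_of_posSemidef {X : Type*} [MeasurableSpace X] (μ : Measure X)
    [IsProbabilityMeasure μ] {k : X → X → ℂ} (hk : (Matrix.of k).PosSemidef)
    (hm : Measurable (Function.uncurry k)) {C : ℝ} (hC : ∀ x y, ‖k x y‖ ≤ C) :
    0 ≤ ∫ z, k z.1 z.2 ∂(μ.prod μ) := by
  set b := ∫ z, k z.1 z.2 ∂(μ.prod μ) with hb
  set a := ∫ x, k x x ∂μ with ha
  have hmd : Measurable fun x => k x x := hm.comp (measurable_id.prodMk measurable_id)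
  have key : ∀ n : ℕ, 0 ≤ ((n : ℂ) + 1)⁻¹ * a + b := by
    intro m
    let n := m + 2
    let P := Measure.pi fun _ : Fin n => μ
    have hev : ∀ i : Fin n, Measurable fun x : Fin n → X => x i := fun i => measurable_pi_apply i
    have hpair : ∀ i j : Fin n, Measurable fun x : Fin n → X => k (x i) (x j) := fun i j =>
      hm.comp ((hev i).prodMk (hev j))
    have hint : ∀ i j : Fin n, Integrable (fun x : Fin n → X => k (x i) (x j)) P := fun i j =>
      Integrable.of_bound (hpair i j).aestronglyMeasurable C (Eventually.of_forall fun x => hC _ _)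
    have hd : ∀ i, ∫ x, k (x i) (x i) ∂P = a := by
      intro i
      rw [ha, ← (measurePreserving_eval (fun _ : Fin n => μ) i).map_eq,
        integral_map (measurable_pi_apply i).aemeasurable hmd.aestronglyMeasurable]
    have hod : ∀ i j, i ≠ j → ∫ x, k (x i) (x j) ∂P = b := by
      intro i j hij
      have h1 : iIndepFun (fun (i : Fin n) (x : Fin n → X) => x i) P :=
        iIndepFun_pi (X := fun _ => id) (fun _ => aemeasurable_id)
      have h2 := (indepFun_iff_map_prod_eq_prod_map_map (hev i).aemeasurable
        (hev j).aemeasurable).1 (h1.indepFun hij)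
      have h3 : ∀ i : Fin n, Measure.map (fun x : Fin n → X => x i) P = μ := fun i =>
        (measurePreserving_eval (fun _ : Fin n => μ) i).map_eq
      rw [h3 i, h3 j] at h2
      rw [hb, ← h2, integral_map ((hev i).prodMk (hev j)).aemeasurable
        (f := fun z : X × X => k z.1 z.2) hm.aestronglyMeasurable]
    have h0 : 0 ≤ ∫ x, ∑ i, ∑ j, k (x i) (x j) ∂P :=
      integral_nonneg fun x => sum_sum_nonneg_of_posSemidef hk x
    have h1 : ∫ x, ∑ i, ∑ j, k (x i) (x j) ∂P = n * a + n * (n - 1) * b := by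
      rw [integral_finsetSum _ fun i _ => integrable_finsetSum _ fun j _ => hint i j]
      have : ∀ i : Fin n, ∫ x, ∑ j, k (x i) (x j) ∂P = a + (n - 1) * b := by
        intro i
        rw [integral_finsetSum _ fun j _ => hint i j, ← Finset.add_sum_erase _ _ (Finset.mem_univ i),
          hd, Finset.sum_congr rfl fun j hj => hod i j (Finset.ne_of_mem_erase hj).symm]
        simp [n]
        left
        ring
      simp only [this, Finset.sum_const, Finset.card_univ, Fintype.card_fin, nsmul_eq_mul]
      ring
    rw [h1] at h0
    have h2 : (0 : ℂ) ≤ (((n : ℝ) * (m + 1))⁻¹ : ℝ) :=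
      Complex.zero_le_real.2 (by positivity)
    have h3 := mul_nonneg h2 h0
    convert h3 using 1
    have h4 : (m : ℂ) + 1 ≠ 0 := by exact_mod_cast Nat.succ_ne_zero m
    have h5 : (m : ℂ) + 2 ≠ 0 := by exact_mod_cast Nat.succ_ne_zero (m + 1)
    simp only [n]
    push_cast
    field_simp
    ring
  have hlim : Tendsto (fun n : ℕ => ((n : ℂ) + 1)⁻¹ * a + b) atTop (𝓝 (0 * a + b)) := by
    refine Tendsto.add (Tendsto.mul_const _ ?_) tendsto_const_nhds
    have := (Complex.continuous_ofReal.tendsto _).comp (tendsto_one_div_add_atTop_nhds_zero_nat (𝕜 := ℝ))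
    simpa [Function.comp_def] using this
  simpa using ge_of_tendsto' hlim key

theorem integral_prod_nonneg_of_posSemidef' {X : Type*} [MeasurableSpace X] (μ : Measure X)
    [IsFiniteMeasure μ] {k : X → X → ℂ} (hk : (Matrix.of k).PosSemidef)
    (hm : Measurable (Function.uncurry k)) {C : ℝ} (hC : ∀ x y, ‖k x y‖ ≤ C) :
    0 ≤ ∫ z, k z.1 z.2 ∂(μ.prod μ) := by
  rcases eq_zero_or_neZero μ with rfl | hμ
  · simp
  have h := integral_prod_nonneg_of_posSemidef ((μ Set.univ)⁻¹ • μ) hk hm hC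
  rw [Measure.prod_smul_left, Measure.prod_smul_right, integral_smul_measure,
    integral_smul_measure] at h
  have h0 : 0 < ((μ Set.univ)⁻¹).toReal := by
    rw [ENNReal.toReal_inv]
    exact inv_pos.2 (ENNReal.toReal_pos (by simpa using hμ.out) (measure_ne_top _ _))
  rw [smul_smul] at h
  have h2 := smul_nonneg (inv_nonneg.2 (mul_pos h0 h0).le) h
  rwa [smul_smul, inv_mul_cancel₀ (mul_pos h0 h0).ne', one_smul] at h2

end Kernels

/-! ### Continuous integrable positive definite functions -/

section PositiveDefinite

theorem posSemidef_inner {ι E : Type*} [NormedAddCommGroup E] [InnerProductSpace ℂ E]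
    (v : ι → E) : (Matrix.of fun i j => inner ℂ (v i) (v j)).PosSemidef := by
  refine ⟨by ext i j; simp, fun x => ?_⟩
  have : (x.sum fun i xi => x.sum fun j xj =>
      star xi * (Matrix.of fun i j => inner ℂ (v i) (v j)) i j * xj)
      = inner ℂ (x.sum fun i xi => xi • v i) (x.sum fun i xi => xi • v i) := by
    rw [Finsupp.sum, Finsupp.sum, sum_inner]
    refine Finset.sum_congr rfl fun i _ => ?_
    rw [inner_sum, Finsupp.sum]
    refine Finset.sum_congr rfl fun j _ => ?_
    rw [inner_smul_left, inner_smul_right, Matrix.of_apply, RCLike.star_def]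
    ring
  rw [this, inner_self_eq_norm_sq_to_K]
  exact Complex.zero_le_real.2 (sq_nonneg _) |>.trans_eq (Complex.ofReal_pow _ _)

theorem posSemidef_star_mul_mul {ι : Type*} {T : Matrix ι ι ℂ} (hT : T.PosSemidef) (c : ι → ℂ) :
    (Matrix.of fun i j => star (c i) * T i j * c j).PosSemidef := by
  have h : (Matrix.of fun i j => star (c i) * T i j * c j)
      = (Matrix.of fun i j => inner ℂ (c i) (c j)) ⊙ T := by
    ext i j
    simp [mul_comm, mul_left_comm]
  rw [h]
  exact (posSemidef_inner c).hadamard hT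

section Fourier

open scoped FourierTransform RealInnerProductSpace
open Module

variable {V : Type*} [NormedAddCommGroup V] [InnerProductSpace ℝ V] [MeasurableSpace V]
  [BorelSpace V] [FiniteDimensional ℝ V]

/-- A positive definite function has nonnegative integral against a centred isotropic Gaussian
density, since this density is a multiple of the law of the difference of two independent
Gaussian variables. -/
theorem integral_gaussian_smul_nonneg {H : V → ℂ}
    (hpd : (Matrix.of fun p q => H (q - p)).PosSemidef) (hc : Continuous H) (hi : Integrable H)
    {C : ℝ} (hC : ∀ v, ‖H v‖ ≤ C) {δ : ℝ} (hδ : 0 < δ) :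
    0 ≤ ∫ v, Real.exp (-(δ / 2) * ‖v‖ ^ 2) • H v := by
  set g : V → ℝ := fun v => Real.exp (-δ * ‖v‖ ^ 2) with hg
  have hgc : Continuous g := by fun_prop
  have hg0 : ∀ v, 0 ≤ g v := fun v => (Real.exp_pos _).le
  have hg1 : ∀ v, g v ≤ 1 := fun v => by
    rw [hg]
    exact Real.exp_le_one_iff.2 (by nlinarith [sq_nonneg ‖v‖])
  have hgi : ∀ b : ℝ, 0 < b → Integrable fun v : V => Real.exp (-b * ‖v‖ ^ 2) := by
    intro b hb
    have h := (GaussianFourier.integrable_cexp_neg_mul_sq_norm_add (V := V) (b := b)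
      (by simpa) 0 0).norm
    refine h.congr (Eventually.of_forall fun v => ?_)
    simp only [zero_mul, add_zero]
    rw [show -(b : ℂ) * (‖v‖ : ℂ) ^ 2 = ((-b * ‖v‖ ^ 2 : ℝ) : ℂ) by push_cast; ring,
      Complex.norm_exp_ofReal]
  let μ : Measure V := volume.withDensity fun v => ENNReal.ofReal (g v)
  have : IsFiniteMeasure μ := isFiniteMeasure_withDensity_ofReal (hgi δ hδ).2
  have hμ : ∀ f : V → ℂ, ∫ v, f v ∂μ = ∫ v, g v • f v := by
    intro f
    rw [integral_withDensity_eq_integral_toReal_smul (by fun_prop)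
      (Eventually.of_forall fun v => ENNReal.ofReal_lt_top)]
    refine integral_congr_ae (Eventually.of_forall fun v => ?_)
    simp only [ENNReal.toReal_ofReal (hg0 v)]
  have hcont : Continuous (Function.uncurry fun p q : V => H (q - p)) := by fun_prop
  have h0 := integral_prod_nonneg_of_posSemidef' μ hpd hcont.measurable (fun p q => hC (q - p))
  rw [integral_prod (fun z : V × V => H (z.2 - z.1)) (Integrable.of_bound
    (hcont.aestronglyMeasurable) C (Eventually.of_forall fun z => hC _)), hμ] at h0
  have h1 : ∀ p : V, ∫ q, H (q - p) ∂μ = ∫ r, g (r + p) • H r := by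
    intro p
    rw [hμ, ← integral_add_right_eq_self _ p]
    simp
  simp only [h1] at h0
  have h2 : Integrable (Function.uncurry fun p r : V => g p • g (r + p) • H r)
      (volume.prod volume) := by
    have := (hgi δ hδ).ofReal (𝕜 := ℂ) |>.mul_prod hi
    refine this.mono (Continuous.aestronglyMeasurable (by fun_prop))
      (Eventually.of_forall fun z => ?_)
    simp only [Function.uncurry, norm_smul, norm_mul, Real.norm_eq_abs, abs_of_nonneg (hg0 _),
      RCLike.norm_ofReal, Real.abs_exp]
    exact mul_le_mul_of_nonneg_left (mul_le_of_le_one_left (norm_nonneg _) (hg1 _)) (hg0 _)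
  have h3 : ∀ p : V, g p • ∫ r, g (r + p) • H r = ∫ r, g p • g (r + p) • H r := fun p =>
    (integral_smul _ _).symm
  simp only [h3] at h0
  rw [integral_integral_swap h2] at h0
  -- completing the square: `|p|² + |r + p|² = 2 |p + r/2|² + |r|²/2`
  have h4 : ∀ r : V, ∫ p, g p • g (r + p) • H r
      = (∫ p : V, Real.exp (-(2 * δ) * ‖p‖ ^ 2)) • Real.exp (-(δ / 2) * ‖r‖ ^ 2) • H r := by
    intro r
    rw [← integral_add_right_eq_self (fun p : V => Real.exp (-(2 * δ) * ‖p‖ ^ 2))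
      ((1 / 2 : ℝ) • r), ← integral_smul_const]
    refine integral_congr_ae (Eventually.of_forall fun p => ?_)
    simp only [smul_smul, hg, ← Real.exp_add]
    congr 2
    simp only [← real_inner_self_eq_norm_sq, inner_add_left, inner_add_right, inner_smul_left,
      inner_smul_right, real_inner_comm]
    simp [real_inner_comm p r]
    ring
  simp only [h4, integral_smul] at h0
  have h5 : 0 < ∫ p : V, Real.exp (-(2 * δ) * ‖p‖ ^ 2) := by
    refine integral_exp_pos (hgi _ (by positivity))
  have h6 := smul_nonneg (inv_nonneg.2 h5.le) h0
  rwa [smul_smul, inv_mul_cancel₀ h5.ne', one_smul] at h6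

/-- The Fourier integral is a limit of Gaussian averages of the function times a character, and
this product is again positive definite. -/
theorem fourier_nonneg_of_posDef {F : V → ℂ}
    (hpd : (Matrix.of fun p q => F (q - p)).PosSemidef) (hc : Continuous F) (hi : Integrable F)
    {C : ℝ} (hC : ∀ v, ‖F v‖ ≤ C) (w : V) : 0 ≤ 𝓕 F w := by
  set H : V → ℂ := fun v => Real.fourierChar (-⟪v, w⟫) • F v with hH
  have hHc : Continuous H := by
    have h : Continuous fun v : V => -⟪v, w⟫ := by fun_prop
    exact (continuous_subtype_val.comp (Real.continuous_fourierChar.comp h)).smul hc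
  have hHn : ∀ v, ‖H v‖ = ‖F v‖ := fun v => Circle.norm_smul _ _
  have hHi : Integrable H := hi.congr' hHc.aestronglyMeasurable
    (Eventually.of_forall fun v => (hHn v).symm)
  have hHpd : (Matrix.of fun p q => H (q - p)).PosSemidef := by
    have := posSemidef_star_mul_mul hpd (fun p => (Real.fourierChar (-⟪p, w⟫) : ℂ))
    convert this using 1
    ext p q
    simp only [hH, Matrix.of_apply, inner_sub_left, Circle.smul_def]
    rw [show -(⟪q, w⟫ - ⟪p, w⟫) = -(-⟪p, w⟫) + -⟪q, w⟫ by ring, AddChar.map_add_eq_mul,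
      AddChar.map_neg_eq_inv]
    rw [Circle.coe_mul, Circle.coe_inv_eq_conj]
    simp only [smul_eq_mul, RCLike.star_def]
    ring
  rw [Real.fourier_eq]
  refine ge_of_tendsto (Real.tendsto_integral_cexp_sq_smul hHi) ?_
  filter_upwards [Ioi_mem_atTop 0] with c hc'
  have := integral_gaussian_smul_nonneg hHpd hHc hHi (fun v => (hHn v).le.trans (hC v))
    (δ := 2 * c⁻¹) (by have : 0 < c := hc'; positivity)
  refine this.trans_eq (integral_congr_ae (Eventually.of_forall fun v => ?_))
  change Real.exp _ • H v = _ • H v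
  rw [← Complex.coe_smul, smul_eq_mul, smul_eq_mul]
  push_cast
  ring_nf

/-- Gaussian summation of the inversion integral at the origin, without integrability of `𝓕 F`. -/
theorem tendsto_integral_gaussian_smul_fourier {F : V → ℂ} (hc : Continuous F)
    (hi : Integrable F) :
    Tendsto (fun c : ℝ => ∫ w : V, Complex.exp (-c⁻¹ * ‖w‖ ^ 2) • 𝓕 F w) atTop (𝓝 (F 0)) := by
  refine (Real.tendsto_integral_gaussian_smul' hi (hc.continuousAt (x := 0))).congr' ?_
  filter_upwards [Ioi_mem_atTop 0] with c (hc : 0 < c)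
  have J : Integrable (fun w : V ↦ Complex.exp (- c⁻¹ * ‖w‖ ^ 2)) := by
    simpa using GaussianFourier.integrable_cexp_neg_mul_sq_norm_add (V := V)
      (b := (c : ℂ)⁻¹) (by rw [← Complex.ofReal_inv]; simpa using hc) 0 0
  have h := VectorFourier.integral_fourierIntegral_smul_eq_flip (L := innerₗ V)
      Real.continuous_fourierChar continuous_inner J hi
  have h' : ∫ w : V, 𝓕 (fun w : V => Complex.exp (-c⁻¹ * ‖w‖ ^ 2)) w • F w
      = ∫ w : V, Complex.exp (-c⁻¹ * ‖w‖ ^ 2) • 𝓕 F w := by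
    simpa using! h
  rw [← h']
  congr with w
  have h2 := fourier_gaussian_innerProductSpace' (V := V) (b := (c : ℂ)⁻¹)
    (by rw [← Complex.ofReal_inv]; simpa using hc) 0 w
  simp only [mul_zero, Complex.ofReal_zero, inner_zero_left, add_zero] at h2
  rw [Complex.ofReal_inv, h2]
  congr 2
  · simp
  · simp; ring_nf

/-- A continuous integrable positive definite function has an integrable Fourier transform:
as the latter is nonnegative, its Gaussian regularisations, whose integrals converge, bound its
integral by Fatou's lemma. -/
theorem integrable_fourier_of_posDef {F : V → ℂ}
    (hpd : (Matrix.of fun p q => F (q - p)).PosSemidef) (hc : Continuous F) (hi : Integrable F)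
    {C : ℝ} (hC : ∀ v, ‖F v‖ ≤ C) : Integrable (𝓕 F) := by
  have hpos := fourier_nonneg_of_posDef hpd hc hi hC
  have hcont : Continuous (𝓕 F) :=
    VectorFourier.fourierIntegral_continuous Real.continuous_fourierChar continuous_inner hi
  have hbd : ∀ w, ‖𝓕 F w‖ ≤ ∫ v, ‖F v‖ := fun w =>
    VectorFourier.norm_fourierIntegral_le_integral_norm _ _ _ _ _
  let g : ℕ → V → ℂ := fun n w => Complex.exp (-((n : ℝ) : ℂ)⁻¹ * ‖w‖ ^ 2) • 𝓕 F w
  have hexp : ∀ (n : ℕ) (w : V), Complex.exp (-((n : ℝ) : ℂ)⁻¹ * ‖w‖ ^ 2)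
      = (Real.exp (-(n : ℝ)⁻¹ * ‖w‖ ^ 2) : ℝ) := fun n w => by push_cast; rfl
  have hg0 : ∀ n w, 0 ≤ g n w := fun n w => by
    simp only [g, hexp]
    exact mul_nonneg (Complex.zero_le_real.2 (Real.exp_pos _).le) (hpos w)
  have hgn : ∀ n w, ‖g n w‖ = (g n w).re := fun n w => by
    rw [congrArg Complex.re (Complex.eq_coe_norm_of_nonneg (hg0 n w)), Complex.ofReal_re]
  have hglim : ∀ w, Tendsto (fun n => g n w) atTop (𝓝 (𝓕 F w)) := by
    intro w
    have h : Tendsto (fun n : ℕ => Real.exp (-(n : ℝ)⁻¹ * ‖w‖ ^ 2)) atTop (𝓝 1) := by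
      have h1 : Tendsto (fun n : ℕ => -(n : ℝ)⁻¹ * ‖w‖ ^ 2) atTop (𝓝 (-0 * ‖w‖ ^ 2)) :=
        (tendsto_inv_atTop_nhds_zero_nat.neg).mul_const _
      simpa [Function.comp_def] using (Real.continuous_exp.tendsto _).comp h1
    have h2 := ((Complex.continuous_ofReal.tendsto _).comp h).smul_const (𝓕 F w)
    simpa [g, hexp, Function.comp_def] using h2
  have hgi : ∀ n, n ≠ 0 → Integrable (g n) := by
    intro n hn
    have J : Integrable (fun w : V ↦ Complex.exp (-((n : ℝ) : ℂ)⁻¹ * ‖w‖ ^ 2)) := by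
      simpa using GaussianFourier.integrable_cexp_neg_mul_sq_norm_add (V := V)
        (b := ((n : ℝ) : ℂ)⁻¹) (by rw [← Complex.ofReal_inv]; simpa using Nat.pos_of_ne_zero hn) 0 0
    exact J.mul_bdd (c := ∫ v, ‖F v‖) hcont.aestronglyMeasurable (Eventually.of_forall hbd)
  have hint : Tendsto (fun n => ∫⁻ w, ‖g n w‖ₑ) atTop (𝓝 (ENNReal.ofReal (F 0).re)) := by
    have h1 := (tendsto_integral_gaussian_smul_fourier hc hi).comp tendsto_natCast_atTop_atTop
    have h2 := (ENNReal.continuous_ofReal.tendsto _).comp ((Complex.continuous_re.tendsto _).comp h1)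
    refine h2.congr' ?_
    filter_upwards [eventually_ne_atTop 0] with n hn
    rw [← ofReal_integral_norm_eq_lintegral_enorm (hgi n hn)]
    simp only [hgn, Function.comp_apply]
    congr 1
    refine Eq.trans ?_ (integral_re (hgi n hn)).symm
    simp [g]
  refine ⟨hcont.aestronglyMeasurable, ?_⟩
  have hlim : ∀ w, liminf (fun n => ‖g n w‖ₑ) atTop = ‖𝓕 F w‖ₑ := fun w =>
    ((continuous_enorm.tendsto _).comp (hglim w)).liminf_eq
  rw [HasFiniteIntegral]
  calc ∫⁻ w, ‖𝓕 F w‖ₑ = ∫⁻ w, liminf (fun n => ‖g n w‖ₑ) atTop := by simp only [hlim]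
    _ ≤ liminf (fun n => ∫⁻ w, ‖g n w‖ₑ) atTop := lintegral_liminf_le fun n => by
        have : Continuous (g n) := by fun_prop
        exact this.enorm.measurable
    _ = ENNReal.ofReal (F 0).re := hint.liminf_eq
    _ < ⊤ := ENNReal.ofReal_lt_top

theorem integral_fourierChar_smul_fourier {F : V → ℂ}
    (hpd : (Matrix.of fun p q => F (q - p)).PosSemidef) (hc : Continuous F) (hi : Integrable F)
    {C : ℝ} (hC : ∀ v, ‖F v‖ ≤ C) (v : V) : ∫ w, Real.fourierChar ⟪w, v⟫ • 𝓕 F w = F v := by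
  rw [← hi.fourierInv_fourier_eq (integrable_fourier_of_posDef hpd hc hi hC) hc.continuousAt,
    Real.fourierInv_eq]

end Fourier

end PositiveDefinite

/-! ### Weyl operators -/

section Weyl

theorem dotProduct_symplectic_mulVec {N : ℕ} (x y : PhaseIdx N → ℝ) :
    x ⬝ᵥ symplectic N *ᵥ y = ∑ j, (x (0, j) * y (1, j) - x (1, j) * y (0, j)) := by
  simp only [dotProduct, Matrix.mulVec, symplectic, Fintype.sum_prod_type, Fin.sum_univ_two,
    Matrix.blockDiagonal_apply]
  simp [sub_eq_add_neg, Finset.sum_add_distrib]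

/-- The Weyl form of the canonical commutation relations. -/
theorem weyl_weyl {N : ℕ} (x y : PhaseIdx N → ℝ) (ψ : Hilb N) :
    weyl x (weyl y ψ) =
      Complex.exp (-(Complex.I / 2) * ((x ⬝ᵥ symplectic N *ᵥ y : ℝ) : ℂ)) • weyl (x + y) ψ := by
  refine Lp.ext ?_
  refine (weyl_coeFn x _).trans ((weylFun_congr x (weyl_coeFn y ψ)).trans ?_)
  refine EventuallyEq.trans ?_ (Lp.coeFn_smul _ _).symm
  filter_upwards [weyl_coeFn (x + y) ψ] with t ht
  simp only [Pi.smul_apply, ht, weylFun, smul_eq_mul, ← mul_assoc, ← Complex.exp_add]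
  congr 1
  · congr 1
    rw [dotProduct_symplectic_mulVec]
    simp only [Pi.sub_apply, Pi.add_apply, mul_sub, add_mul, mul_add, Finset.sum_add_distrib,
      Finset.sum_sub_distrib]
    push_cast
    simp only [mul_comm]
    ring
  · congr 1
    ext j
    simp [sub_sub]

theorem weyl_zero {N : ℕ} (ψ : Hilb N) : weyl 0 ψ = ψ := by
  refine Lp.ext ?_
  filter_upwards [weyl_coeFn 0 ψ] with t ht
  rw [ht]
  simp only [weylFun, Pi.zero_apply]
  have : (t - fun _ => 0) = t := sub_zero t
  simp [this]

theorem exists_weyl_eq_toContinuousLinearMap {N : ℕ} (x : PhaseIdx N → ℝ) :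
    ∃ U : Hilb N →ₗᵢ[ℂ] Hilb N, weyl x = U.toContinuousLinearMap := ⟨_, rfl⟩

theorem norm_weyl {N : ℕ} (x : PhaseIdx N → ℝ) (ψ : Hilb N) : ‖weyl x ψ‖ = ‖ψ‖ := by
  obtain ⟨U, hU⟩ := exists_weyl_eq_toContinuousLinearMap x
  rw [hU]
  exact U.norm_map ψ

theorem inner_weyl_weyl_self {N : ℕ} (x : PhaseIdx N → ℝ) (φ ψ : Hilb N) :
    inner ℂ (weyl x φ) (weyl x ψ) = inner ℂ φ ψ := by
  obtain ⟨U, hU⟩ := exists_weyl_eq_toContinuousLinearMap x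
  rw [hU]
  exact U.inner_map_map φ ψ

theorem dotProduct_symplectic_self {N : ℕ} (x : PhaseIdx N → ℝ) :
    x ⬝ᵥ symplectic N *ᵥ x = 0 := by
  rw [dotProduct_symplectic_mulVec]
  exact Finset.sum_eq_zero fun j _ => by ring

theorem dotProduct_symplectic_swap {N : ℕ} (x y : PhaseIdx N → ℝ) :
    y ⬝ᵥ symplectic N *ᵥ x = -(x ⬝ᵥ symplectic N *ᵥ y) := by
  rw [dotProduct_symplectic_mulVec, dotProduct_symplectic_mulVec, ← Finset.sum_neg_distrib]
  exact Finset.sum_congr rfl fun j _ => by ring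

/-- The Weyl relation turns a matrix element at a difference of phase space points into an entry
of a Gram matrix, up to a phase. -/
theorem inner_weyl_sub {N : ℕ} (x y : PhaseIdx N → ℝ) (φ ψ : Hilb N) :
    inner ℂ φ (weyl (y - x) ψ) =
      Complex.exp (-(Complex.I / 2) * ((x ⬝ᵥ symplectic N *ᵥ y : ℝ) : ℂ)) *
        inner ℂ (weyl x φ) (weyl y ψ) := by
  rw [← inner_weyl_weyl_self x φ, weyl_weyl, inner_smul_right, add_sub_cancel, Matrix.mulVec_sub,
    dotProduct_sub, dotProduct_symplectic_self, sub_zero]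

theorem exists_ne_zero_hilb (N : ℕ) : ∃ ψ : Hilb N, ψ ≠ 0 := by
  have h1 : volume (Metric.ball (0 : Fin N → ℝ) 1) ≠ ∞ := measure_ball_lt_top.ne
  refine ⟨indicatorConstLp 2 measurableSet_ball h1 1, fun h0 => ?_⟩
  have h2 := congrArg norm h0
  rw [norm_indicatorConstLp two_ne_zero ENNReal.ofNat_ne_top, norm_zero, norm_one, one_mul] at h2
  have h3 : 0 < volume.real (Metric.ball (0 : Fin N → ℝ) 1) :=
    ENNReal.toReal_pos (Metric.measure_ball_pos _ _ one_pos).ne' h1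
  exact (Real.rpow_pos_of_pos h3 _).ne' h2

/-- The commutation relations determine the phase space point of a Weyl operator, even when the
operator is only known up to a scalar factor. -/
theorem eq_of_smul_weyl_eq_smul_weyl {N : ℕ} {x y : PhaseIdx N → ℝ} {b c : ℂ} (hb : b ≠ 0)
    (h : b • weyl x = c • weyl y) : x = y := by
  obtain ⟨ψ, hψ⟩ := exists_ne_zero_hilb N
  have hphase : ∀ z, Complex.exp (-Complex.I * ((x ⬝ᵥ symplectic N *ᵥ z : ℝ) : ℂ))
      = Complex.exp (-Complex.I * ((y ⬝ᵥ symplectic N *ᵥ z : ℝ) : ℂ)) := by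
    have hcomm : ∀ (w z : PhaseIdx N → ℝ) (χ : Hilb N), weyl w (weyl z χ)
        = Complex.exp (-Complex.I * ((w ⬝ᵥ symplectic N *ᵥ z : ℝ) : ℂ)) • weyl z (weyl w χ) := by
      intro w z χ
      rw [weyl_weyl, weyl_weyl, smul_smul, ← Complex.exp_add, dotProduct_symplectic_swap w z,
        add_comm z w]
      congr 2
      push_cast
      ring
    intro z
    have h1 : ∀ χ : Hilb N, b • weyl x χ = c • weyl y χ := fun χ => by
      simpa using congrArg (fun T : Hilb N →L[ℂ] Hilb N => T χ) h
    have h2 := h1 (weyl z ψ)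
    rw [hcomm x, hcomm y, smul_comm b, smul_comm c, ← map_smul (weyl z) b, ← map_smul (weyl z) c,
      ← h1 ψ] at h2
    have h3 : weyl z (b • weyl x ψ) ≠ 0 := by
      rw [← norm_ne_zero_iff, norm_weyl, norm_smul, norm_weyl]
      exact mul_ne_zero (norm_ne_zero_iff.2 hb) (norm_ne_zero_iff.2 hψ)
    exact smul_left_injective ℂ h3 h2
  -- a linear form whose values on every line through the origin are multiples of `2π` vanishes
  have hzero : ∀ z, (x - y) ⬝ᵥ symplectic N *ᵥ z = 0 := by
    intro z
    by_contra hne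
    set s := (x - y) ⬝ᵥ symplectic N *ᵥ z with hs
    -- scaling `z` so that the form takes the value `1`, which is not a multiple of `2π`
    have h1 := hphase ((1 / s) • z)
    rw [← sub_eq_zero] at h1
    have h2 : Complex.exp (-Complex.I * ((x - y) ⬝ᵥ symplectic N *ᵥ ((1 / s) • z) : ℝ)) = 1 := by
      rw [sub_dotProduct]
      push_cast
      rw [mul_sub, Complex.exp_sub, sub_eq_zero.1 h1, div_self (Complex.exp_ne_zero _)]
    rw [Matrix.mulVec_smul, dotProduct_smul, ← hs, smul_eq_mul, one_div_mul_cancel hne,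
      Complex.exp_eq_one_iff] at h2
    obtain ⟨n, hn⟩ := h2
    have h3 := congrArg Complex.im hn
    simp at h3
    have h4 : |(n : ℝ)| * (2 * Real.pi) = 1 := by
      rw [← abs_of_pos Real.two_pi_pos, ← abs_mul, ← h3]
      simp
    rcases eq_or_ne n 0 with rfl | hn0
    · simp at h4
    · have h5 : (1 : ℝ) ≤ |(n : ℝ)| := by exact_mod_cast Int.one_le_abs hn0
      nlinarith [Real.pi_gt_three]
  rw [← sub_eq_zero]
  ext ⟨i, j⟩
  have h0 := hzero (Pi.single (0, j) 1)
  have h1 := hzero (Pi.single (1, j) 1)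
  rw [dotProduct_symplectic_mulVec] at h0 h1
  simp [Pi.single_apply] at h0 h1
  fin_cases i
  · simpa using h1
  · change x (1, j) - y (1, j) = 0
    linarith

/-- Translations act continuously on `L²`. -/
theorem continuous_weyl_position {N : ℕ} (ψ : Hilb N) :
    Continuous fun x : PhaseIdx N → ℝ => weyl (fun i => if i.1 = 0 then x i else 0) ψ := by
  have : Fact ((2 : ℝ≥0∞) ≠ ∞) := ⟨ENNReal.ofNat_ne_top⟩
  have h : ∀ x : PhaseIdx N → ℝ, weyl (fun i => if i.1 = 0 then x i else 0) ψ
      = DomAddAct.mk (-fun j => x (0, j)) +ᵥ ψ := by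
    intro x
    refine Lp.ext ((weyl_coeFn _ _).trans ?_)
    refine EventuallyEq.trans (Eventually.of_forall fun t => ?_) (DomAddAct.vadd_Lp_ae_eq _ _).symm
    simp only [weylFun]
    simp
    congr 1
    abel
  simp only [h]
  have h2 : Continuous fun x : PhaseIdx N → ℝ => DomAddAct.mk (-fun j => x (0, j)) :=
    DomAddAct.continuous_mk.comp (by fun_prop)
  exact h2.vadd continuous_const

theorem continuous_inner_weyl_momentum {N : ℕ} (φ ψ : Hilb N) :
    Continuous fun x : PhaseIdx N → ℝ =>
      inner ℂ φ (weyl (fun i => if i.1 = 1 then x i else 0) ψ) := by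
  have h : ∀ x : PhaseIdx N → ℝ, inner ℂ φ (weyl (fun i => if i.1 = 1 then x i else 0) ψ)
      = ∫ t, Complex.exp (Complex.I * ((∑ j, x (1, j) * t j : ℝ) : ℂ)) * inner ℂ (φ t) (ψ t) := by
    intro x
    rw [L2.inner_def]
    refine integral_congr_ae ?_
    filter_upwards [weyl_coeFn (fun i => if i.1 = 1 then x i else 0) ψ] with t ht
    have : (t - fun _ => 0) = t := sub_zero t
    rw [ht]
    simp [weylFun, this]
    ring
  simp only [h]
  refine continuous_of_dominated (bound := fun t => ‖inner ℂ (φ t) (ψ t)‖) (fun x => ?_)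
    (fun x => Eventually.of_forall fun t => ?_) (L2.integrable_inner φ ψ).norm
    (Eventually.of_forall fun t => by fun_prop)
  · exact (Continuous.aestronglyMeasurable (by fun_prop)).mul (L2.integrable_inner φ ψ).1
  · rw [norm_mul, mul_comm Complex.I, Complex.norm_exp_ofReal_mul_I, one_mul]

/-- Weyl operators are weakly continuous in the phase space point. -/
theorem continuous_inner_weyl {N : ℕ} (φ ψ : Hilb N) :
    Continuous fun x : PhaseIdx N → ℝ => inner ℂ φ (weyl x ψ) := by
  -- `W(x)` is, up to a continuous phase, a modulation (weakly continuous) after a translation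
  -- (strongly continuous); as modulations are isometric this suffices for joint weak continuity
  let Q : (PhaseIdx N → ℝ) → PhaseIdx N → ℝ := fun x i => if i.1 = 0 then x i else 0
  let P : (PhaseIdx N → ℝ) → PhaseIdx N → ℝ := fun x i => if i.1 = 1 then x i else 0
  have hPQ : ∀ x, P x + Q x = x := by
    intro x
    ext ⟨i, j⟩
    fin_cases i <;> simp [P, Q]
  have hx : ∀ x, inner ℂ φ (weyl x ψ) =
      Complex.exp (Complex.I / 2 * ((P x ⬝ᵥ symplectic N *ᵥ Q x : ℝ) : ℂ)) *
        inner ℂ φ (weyl (P x) (weyl (Q x) ψ)) := by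
    intro x
    rw [weyl_weyl, hPQ, inner_smul_right, ← mul_assoc, ← Complex.exp_add]
    simp
  have hP : Continuous P := continuous_pi fun i => by
    by_cases h : i.1 = 1 <;> simp only [P, h, if_true, if_false] <;> fun_prop
  have hQ : Continuous Q := continuous_pi fun i => by
    by_cases h : i.1 = 0 <;> simp only [Q, h, if_true, if_false] <;> fun_prop
  have hΩ : Continuous fun x => (P x ⬝ᵥ symplectic N *ᵥ Q x) := by
    simp only [dotProduct, Matrix.mulVec]
    fun_prop
  simp only [hx]
  refine Continuous.mul (by fun_prop) (continuous_iff_continuousAt.2 fun x₀ => ?_)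
  have h1 : Tendsto (fun x => inner ℂ φ (weyl (P x) (weyl (Q x₀) ψ))) (𝓝 x₀)
      (𝓝 (inner ℂ φ (weyl (P x₀) (weyl (Q x₀) ψ)))) :=
    (continuous_inner_weyl_momentum φ (weyl (Q x₀) ψ)).tendsto x₀
  have h2 : Tendsto (fun x => inner ℂ φ (weyl (P x) (weyl (Q x) ψ - weyl (Q x₀) ψ))) (𝓝 x₀)
      (𝓝 0) := by
    refine squeeze_zero_norm (a := fun x => ‖φ‖ * ‖weyl (Q x) ψ - weyl (Q x₀) ψ‖) (fun x => ?_) ?_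
    · exact (norm_inner_le_norm _ _).trans_eq (by rw [norm_weyl])
    · have h3 := ((continuous_weyl_position ψ).tendsto x₀).sub_const (weyl (Q x₀) ψ)
      simpa [Q] using h3.norm.const_mul ‖φ‖
  have h3 := h1.add h2
  simp only [← inner_add_right, ← map_add, add_sub_cancel, add_zero] at h3
  exact h3

end Weyl

/-! ### Sesquilinear forms and observables with a density -/

section Forms

variable {H : Type*} [NormedAddCommGroup H] [InnerProductSpace ℂ H]

theorem sesq_polarization {E : Type*} [AddCommGroup E] [Module ℂ E] (b : H →ₗ⋆[ℂ] H →ₗ[ℂ] E)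
    (φ ψ : H) : b φ ψ = (4⁻¹ : ℂ) • (b (φ + ψ) (φ + ψ) - b (φ - ψ) (φ - ψ)
      - Complex.I • b (φ + Complex.I • ψ) (φ + Complex.I • ψ)
      + Complex.I • b (φ - Complex.I • ψ) (φ - Complex.I • ψ)) := by
  simp only [map_add, map_sub, LinearMap.add_apply, LinearMap.sub_apply, LinearMap.map_smulₛₗ,
    LinearMap.smul_apply, Complex.conj_I, RingHom.id_apply]
  match_scalars <;> simp
  all_goals ring_nf

/-- A sesquilinear form bounded on the diagonal is bounded, by polarisation and the parallelogram
law. -/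
theorem norm_sesq_le {b : H →ₗ⋆[ℂ] H →ₗ[ℂ] ℂ} {C : ℝ} (hb : ∀ ψ, ‖b ψ ψ‖ ≤ C * ‖ψ‖ ^ 2)
    (φ ψ : H) : ‖b φ ψ‖ ≤ 2 * C * ‖φ‖ * ‖ψ‖ := by
  have h1 : ∀ φ ψ : H, ‖b φ ψ‖ ≤ C * (‖φ‖ ^ 2 + ‖ψ‖ ^ 2) := by
    intro φ ψ
    have p1 := parallelogram_law_with_norm ℂ φ ψ
    have p2 := parallelogram_law_with_norm ℂ φ (Complex.I • ψ)
    rw [norm_smul, Complex.norm_I, one_mul] at p2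
    have hn : ‖(4⁻¹ : ℂ)‖ = 4⁻¹ := by simp
    rw [sesq_polarization b φ ψ, norm_smul, hn]
    have t1 := norm_add_le (b (φ + ψ) (φ + ψ) - b (φ - ψ) (φ - ψ)
      - Complex.I • b (φ + Complex.I • ψ) (φ + Complex.I • ψ))
      (Complex.I • b (φ - Complex.I • ψ) (φ - Complex.I • ψ))
    have t2 := norm_sub_le (b (φ + ψ) (φ + ψ) - b (φ - ψ) (φ - ψ))
      (Complex.I • b (φ + Complex.I • ψ) (φ + Complex.I • ψ))
    have t3 := norm_sub_le (b (φ + ψ) (φ + ψ)) (b (φ - ψ) (φ - ψ))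
    rw [norm_smul, Complex.norm_I, one_mul] at t1 t2
    have e1 := hb (φ + ψ)
    have e2 := hb (φ - ψ)
    have e3 := hb (φ + Complex.I • ψ)
    have e4 := hb (φ - Complex.I • ψ)
    have q1 : C * ‖φ + ψ‖ ^ 2 + C * ‖φ - ψ‖ ^ 2 = 2 * (C * (‖φ‖ ^ 2 + ‖ψ‖ ^ 2)) := by
      linear_combination C * p1
    have q2 : C * ‖φ + Complex.I • ψ‖ ^ 2 + C * ‖φ - Complex.I • ψ‖ ^ 2
        = 2 * (C * (‖φ‖ ^ 2 + ‖ψ‖ ^ 2)) := by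
      linear_combination C * p2
    linarith
  rcases eq_or_ne φ 0 with rfl | hφ
  · simp
  rcases eq_or_ne ψ 0 with rfl | hψ
  · simp
  have hφ' : ‖φ‖ ≠ 0 := norm_ne_zero_iff.2 hφ
  have hψ' : ‖ψ‖ ≠ 0 := norm_ne_zero_iff.2 hψ
  have h2 := h1 (((‖φ‖ : ℂ)⁻¹) • φ) (((‖ψ‖ : ℂ)⁻¹) • ψ)
  simp only [LinearMap.map_smulₛₗ, LinearMap.smul_apply, norm_smul, RingHom.id_apply, norm_inv,
    RCLike.norm_conj, Complex.norm_real, norm_norm, inv_mul_cancel₀ hφ', inv_mul_cancel₀ hψ',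
    smul_eq_mul, norm_mul, map_inv₀] at h2
  have h3 : ‖b φ ψ‖ = ‖φ‖ * ‖ψ‖ * (‖ψ‖⁻¹ * (‖φ‖⁻¹ * ‖b φ ψ‖)) := by field_simp
  have h4 : ‖ψ‖⁻¹ * (‖φ‖⁻¹ * ‖b φ ψ‖) ≤ 2 * C := by linarith
  rw [h3]
  have := mul_le_mul_of_nonneg_left h4 (mul_nonneg (norm_nonneg φ) (norm_nonneg ψ))
  linarith

theorem exists_inner_eq_sesq [CompleteSpace H] {b : H →ₗ⋆[ℂ] H →ₗ[ℂ] ℂ} {C : ℝ}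
    (hb : ∀ ψ, ‖b ψ ψ‖ ≤ C * ‖ψ‖ ^ 2) : ∃ T : H →L[ℂ] H, ∀ φ ψ, inner ℂ φ (T ψ) = b φ ψ := by
  refine ⟨ContinuousLinearMap.adjoint (InnerProductSpace.continuousLinearMapOfBilin
    (b.mkContinuous₂ (2 * C) (norm_sesq_le hb))), fun φ ψ => ?_⟩
  rw [ContinuousLinearMap.adjoint_inner_right, InnerProductSpace.continuousLinearMapOfBilin_apply,
    LinearMap.mkContinuous₂_apply]

/-- The sesquilinear form `(φ, ψ) ↦ ⟨φ, T ψ⟩`. -/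
noncomputable def sesqForm (T : H →L[ℂ] H) : H →ₗ⋆[ℂ] H →ₗ[ℂ] ℂ :=
  LinearMap.mk₂'ₛₗ (starRingEnd ℂ) (RingHom.id ℂ)
    (fun φ ψ => inner ℂ φ (T ψ)) (fun _ _ _ => inner_add_left _ _ _)
    (fun _ _ _ => inner_smul_left _ _ _) (fun _ _ _ => by rw [map_add, inner_add_right])
    (fun _ _ _ => by rw [map_smul, inner_smul_right]; rfl)

theorem opNorm_le_of_inner_self_le {T : H →L[ℂ] H} {C : ℝ} (hC : 0 ≤ C)
    (hT : ∀ ψ, ‖inner ℂ ψ (T ψ)‖ ≤ C * ‖ψ‖ ^ 2) : ‖T‖ ≤ 2 * C := by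
  refine T.opNorm_le_bound (by positivity) fun ψ => ?_
  have h := norm_sesq_le (b := sesqForm T) hT (T ψ) ψ
  change ‖inner ℂ (T ψ) (T ψ)‖ ≤ _ at h
  rw [inner_self_eq_norm_sq_to_K, norm_pow, RCLike.norm_ofReal, abs_norm] at h
  rcases eq_or_ne ‖T ψ‖ 0 with h0 | h0
  · rw [h0]; positivity
  · have : 0 < ‖T ψ‖ := lt_of_le_of_ne (norm_nonneg _) h0.symm
    exact le_of_mul_le_mul_left (by linarith) this

/-- A sesquilinear map into the integrable functions, positive on the diagonal and of total
integral `⟨φ, ψ⟩`, is the density of a positive operator valued measure. -/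
theorem exists_povm_of_density [CompleteSpace H] {Ω : Type*} [MeasurableSpace Ω] {ν : Measure Ω}
    (d : H →ₗ⋆[ℂ] H →ₗ[ℂ] (Ω → ℂ)) (hi : ∀ ψ, Integrable (d ψ ψ) ν)
    (hpos : ∀ ψ x, 0 ≤ d ψ ψ x) (htot : ∀ ψ, ∫ x, d ψ ψ x ∂ν = inner ℂ ψ ψ) :
    ∃ E : POVM Ω H, ∀ ψ, ∀ f : Ω → ℂ, Measurable f → ∀ C, (∀ x, ‖f x‖ ≤ C) →
      Integrable f (E.measure ψ) ∧ ∫ x, f x ∂(E.measure ψ) = ∫ x, f x * d ψ ψ x ∂ν := by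
  have hi' : ∀ φ ψ, Integrable (d φ ψ) ν := by
    intro φ ψ
    rw [sesq_polarization d φ ψ]
    exact ((((hi _).sub (hi _)).sub ((hi _).smul _)).add ((hi _).smul _)).smul _
  let b : Set Ω → H →ₗ⋆[ℂ] H →ₗ[ℂ] ℂ := fun X => LinearMap.mk₂'ₛₗ (starRingEnd ℂ) (RingHom.id ℂ)
    (fun φ ψ => ∫ x in X, d φ ψ x ∂ν)
    (fun φ φ' ψ => by
      rw [← integral_add (hi' _ _).integrableOn (hi' _ _).integrableOn]
      simp)
    (fun c φ ψ => by
      rw [← integral_smul]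
      simp [LinearMap.map_smulₛₗ])
    (fun φ ψ ψ' => by
      rw [← integral_add (hi' _ _).integrableOn (hi' _ _).integrableOn]
      simp)
    (fun c φ ψ => by
      rw [← integral_smul]
      simp)
  have hdn : ∀ ψ x, ‖d ψ ψ x‖ = (d ψ ψ x).re := fun ψ x => by
    rw [congrArg Complex.re (Complex.eq_coe_norm_of_nonneg (hpos ψ x)), Complex.ofReal_re]
  have htot' : ∀ φ ψ, b Set.univ φ ψ = inner ℂ φ ψ := by
    intro φ ψ
    let ip : H →ₗ⋆[ℂ] H →ₗ[ℂ] ℂ := innerₛₗ ℂ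
    have hip : ∀ φ ψ, ip φ ψ = inner ℂ φ ψ := fun _ _ => rfl
    have h : ∀ ψ, b Set.univ ψ ψ = ip ψ ψ := fun ψ => by
      rw [hip, ← htot ψ]
      exact congrArg (fun μ => ∫ x, d ψ ψ x ∂μ) Measure.restrict_univ
    rw [← hip, sesq_polarization (b Set.univ), sesq_polarization ip]
    simp only [h]
  have hb : ∀ X ψ, ‖b X ψ ψ‖ ≤ 1 * ‖ψ‖ ^ 2 := by
    intro X ψ
    calc ‖b X ψ ψ‖ ≤ ∫ x in X, ‖d ψ ψ x‖ ∂ν := norm_integral_le_integral_norm _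
      _ ≤ ∫ x, ‖d ψ ψ x‖ ∂ν := setIntegral_le_integral (hi ψ).norm
          (Eventually.of_forall fun x => norm_nonneg _)
      _ = 1 * ‖ψ‖ ^ 2 := by
          simp only [hdn]
          refine (integral_re (hi ψ)).trans ?_
          rw [htot, inner_self_eq_norm_sq, one_mul]
  choose T hT using fun X => exists_inner_eq_sesq (hb X)
  classical
  let E : POVM Ω H :=
    { effect := fun X => if MeasurableSet X then T X else 0
      isPositive := fun X hX => by
        rw [if_pos hX, ContinuousLinearMap.isPositive_iff_complex]
        intro ψ
        have h : 0 ≤ inner ℂ (T X ψ) ψ := by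
          rw [← inner_conj_symm, hT, starRingEnd_apply, star_nonneg_iff]
          exact integral_nonneg (hpos ψ)
        rw [Complex.le_def] at h
        exact ⟨Complex.ext (by simp) (by simpa using h.2), h.1⟩
      effect_univ := by
        rw [if_pos MeasurableSet.univ]
        ext1 ψ
        refine ext_inner_left ℂ fun φ => ?_
        rw [hT, htot']
        rfl
      hasSum_iUnion := fun X hX hd φ ψ => by
        simp only [hX, if_true, MeasurableSet.iUnion hX, hT]
        exact hasSum_integral_iUnion hX hd (hi' φ ψ).integrableOn
      not_measurable := fun X hX => if_neg hX }
  refine ⟨E, fun ψ => ?_⟩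
  have hmeas : E.measure ψ = ν.withDensity fun x => ENNReal.ofReal (d ψ ψ x).re := by
    ext X hX
    rw [E.measure_apply ψ hX, withDensity_apply _ hX]
    have : inner ℂ ψ (E.effect X ψ) = ∫ x in X, d ψ ψ x ∂ν := by
      simp only [E, hX, if_true, hT]
      rfl
    rw [this]
    refine Eq.trans (congrArg ENNReal.ofReal ?_) (ofReal_integral_eq_lintegral_ofReal
      (hi ψ).re.integrableOn (Eventually.of_forall fun x => (Complex.le_def.1 (hpos ψ x)).1))
    exact (integral_re (hi ψ).integrableOn).symm
  intro f hf C hC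
  have hae : AEMeasurable (fun x => ENNReal.ofReal (d ψ ψ x).re) ν :=
    (hi ψ).re.aemeasurable.ennreal_ofReal
  have hfin : IsFiniteMeasure (E.measure ψ) := by
    rw [hmeas]
    exact isFiniteMeasure_withDensity_ofReal (hi ψ).re.2
  refine ⟨Integrable.of_bound hf.aestronglyMeasurable C (Eventually.of_forall hC), ?_⟩
  rw [hmeas, integral_withDensity_eq_integral_toReal_smul₀ hae
    (Eventually.of_forall fun x => ENNReal.ofReal_lt_top)]
  refine integral_congr_ae (Eventually.of_forall fun x => ?_)
  dsimp only
  rw [ENNReal.toReal_ofReal (Complex.le_def.1 (hpos ψ x)).1, ← hdn, ← Complex.coe_smul,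
    ← Complex.eq_coe_norm_of_nonneg (hpos ψ x), smul_eq_mul, mul_comm]

end Forms

/-! ### Existence of Gaussian observables with nonsingular noise -/

section GaussianObservables

open scoped FourierTransform RealInnerProductSpace

variable {M N : ℕ}

theorem norm_gaussFactor {ι : Type*} [Fintype ι] (L : Matrix ι ι ℝ) (m p : ι → ℝ) :
    ‖gaussFactor L m p‖ = Real.exp (-(1 / 4) * (p ⬝ᵥ L *ᵥ p)) := by
  rw [gaussFactor, Complex.norm_exp]
  simp

theorem transpose_eq_of_posSemidef_noiseMatrix {ι : Type*} {K : Matrix (PhaseIdx N) ι ℝ}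
    {L : Matrix ι ι ℝ} (h : (noiseMatrix K L).PosSemidef) : Lᵀ = L := by
  ext i j
  have h1 := congrArg Complex.re (congrFun (congrFun h.1 i) j)
  simpa [noiseMatrix, Matrix.conjTranspose_apply] using h1

theorem dotProduct_noiseMatrix_mulVec {ι : Type*} [Fintype ι] (K : Matrix (PhaseIdx N) ι ℝ)
    (L : Matrix ι ι ℝ) (p q : ι → ℝ) :
    (fun i => (p i : ℂ)) ⬝ᵥ noiseMatrix K L *ᵥ (fun i => (q i : ℂ))
      = ((p ⬝ᵥ L *ᵥ q : ℝ) : ℂ)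
        - Complex.I * ((K *ᵥ p ⬝ᵥ symplectic N *ᵥ (K *ᵥ q) : ℝ) : ℂ) := by
  have h1 : K *ᵥ p ⬝ᵥ symplectic N *ᵥ (K *ᵥ q) = p ⬝ᵥ (Kᵀ * symplectic N * K) *ᵥ q := by
    rw [Matrix.mul_assoc, ← Matrix.mulVec_mulVec, ← Matrix.mulVec_mulVec,
      Matrix.dotProduct_mulVec p, Matrix.vecMul_transpose]
  rw [h1, noiseMatrix, Matrix.sub_mulVec, dotProduct_sub, Matrix.smul_mulVec, dotProduct_smul,
    smul_eq_mul]
  simp [dotProduct, Matrix.mulVec]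

/-- The kernel `pᵀ (L - i KᵀΩK) q` on real vectors is positive semidefinite. -/
theorem posSemidef_noise_kernel {ι : Type*} [Fintype ι] {K : Matrix (PhaseIdx N) ι ℝ}
    {L : Matrix ι ι ℝ} (h : (noiseMatrix K L).PosSemidef) :
    (Matrix.of fun p q : ι → ℝ => ((p ⬝ᵥ L *ᵥ q : ℝ) : ℂ)
      - Complex.I * ((K *ᵥ p ⬝ᵥ symplectic N *ᵥ (K *ᵥ q) : ℝ) : ℂ)).PosSemidef := by
  let u : (ι → ℝ) → ι → ℂ := fun p i => p i
  have hu : ∀ p, star (u p) = u p := fun p => by ext i; simp [u]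
  have hk : ∀ p q, ((p ⬝ᵥ L *ᵥ q : ℝ) : ℂ)
      - Complex.I * ((K *ᵥ p ⬝ᵥ symplectic N *ᵥ (K *ᵥ q) : ℝ) : ℂ)
      = star (u p) ⬝ᵥ noiseMatrix K L *ᵥ u q := fun p q => by
    rw [hu, ← dotProduct_noiseMatrix_mulVec]
  simp only [hk]
  refine ⟨?_, fun x => ?_⟩
  · ext p q
    rw [Matrix.conjTranspose_apply, Matrix.of_apply, Matrix.of_apply, Matrix.star_dotProduct,
      star_star, Matrix.star_mulVec, h.1, ← Matrix.dotProduct_mulVec]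
  · have := h.dotProduct_mulVec_nonneg (x.sum fun p c => c • u p)
    refine this.trans_eq ?_
    simp only [Finsupp.sum, Matrix.mulVec_sum, dotProduct_sum, star_sum, sum_dotProduct,
      star_smul, smul_dotProduct, Matrix.mulVec_smul, dotProduct_smul, smul_eq_mul,
      Matrix.of_apply]
    rw [Finset.sum_comm]
    refine Finset.sum_congr rfl fun p _ => ?_
    rw [Finset.mul_sum]
    refine Finset.sum_congr rfl fun q _ => ?_
    ring

/-- The matrix elements of the candidate characteristic function
`p ↦ e^{-pᵀLp/4 - i mᵀp} W(Kp)`, at the rescaled point `p = 2πv`. The factor `2π` matches the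
normalisation of the Fourier transform. -/
noncomputable def charForm (K : Matrix (PhaseIdx N) (Fin M) ℝ) (L : Matrix (Fin M) (Fin M) ℝ) (m : Fin M → ℝ)
    (φ ψ : Hilb N) (v : EuclideanSpace ℝ (Fin M)) : ℂ :=
  gaussFactor L m ((2 * Real.pi) • v.ofLp) *
    inner ℂ φ (weyl (K *ᵥ ((2 * Real.pi) • v.ofLp)) ψ)

variable {K : Matrix (PhaseIdx N) (Fin M) ℝ} {L : Matrix (Fin M) (Fin M) ℝ} {m : Fin M → ℝ}

/-- The matrix inequality for the parameters makes the characteristic function positive definite: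
the symplectic phase from the Weyl relation and the mixed term of the Gaussian factor combine to
the entrywise exponential of half the kernel `pᵀ (L - i KᵀΩK) q`. -/
theorem posSemidef_charForm (h : (noiseMatrix K L).PosSemidef) (ψ : Hilb N) :
    (Matrix.of fun p q => charForm K L m ψ ψ (q - p)).PosSemidef := by
  have hsymm := transpose_eq_of_posSemidef_noiseMatrix h
  have h1 : ((Matrix.of fun p q : Fin M → ℝ => ((p ⬝ᵥ L *ᵥ q : ℝ) : ℂ)
      - Complex.I * ((K *ᵥ p ⬝ᵥ symplectic N *ᵥ (K *ᵥ q) : ℝ) : ℂ)).map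
      fun z => Complex.exp ((1 / 2 : ℝ) • z)).PosSemidef :=
    posSemidef_map_exp ((posSemidef_noise_kernel h).smul (a := (1 / 2 : ℝ)) (by norm_num))
  have h2 : (Matrix.of fun p q : Fin M → ℝ =>
      inner ℂ (weyl (K *ᵥ p) ψ) (weyl (K *ᵥ q) ψ)).PosSemidef :=
    posSemidef_inner fun p : Fin M → ℝ => weyl (K *ᵥ p) ψ
  have h3 := (posSemidef_star_mul_mul (h1.hadamard h2) (gaussFactor L m)).submatrix
    fun v : EuclideanSpace ℝ (Fin M) => (2 * Real.pi) • v.ofLp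
  convert h3 using 1
  ext v w
  simp only [Matrix.submatrix_apply, Matrix.of_apply, Matrix.hadamard_apply, Matrix.map_apply,
    charForm]
  set p := (2 * Real.pi) • v.ofLp
  set q := (2 * Real.pi) • w.ofLp
  have hpq : (2 * Real.pi) • (w - v).ofLp = q - p := by
    rw [WithLp.ofLp_sub, smul_sub]
  rw [hpq, Matrix.mulVec_sub, inner_weyl_sub]
  have hassoc : ∀ a e i g : ℂ, a * (e * i) * g = a * e * g * i := fun _ _ _ _ => by ring
  rw [hassoc, ← mul_assoc]
  congr 1
  simp only [gaussFactor]
  rw [RCLike.star_def, ← Complex.exp_conj, ← Complex.exp_add, ← Complex.exp_add,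
    ← Complex.exp_add]
  congr 1
  have hqp : q ⬝ᵥ L *ᵥ p = p ⬝ᵥ L *ᵥ q := by
    rw [Matrix.dotProduct_mulVec, ← Matrix.mulVec_transpose, hsymm, dotProduct_comm]
  simp only [Matrix.mulVec_sub, dotProduct_sub, sub_dotProduct, hqp]
  simp only [map_sub, map_mul, map_neg, map_div₀, map_one, map_ofNat, Complex.conj_I,
    Complex.conj_ofReal, Complex.real_smul]
  push_cast
  ring

theorem continuous_charForm (φ ψ : Hilb N) : Continuous (charForm K L m φ ψ) := by
  have h1 : Continuous fun v : EuclideanSpace ℝ (Fin M) => (2 * Real.pi) • v.ofLp := by fun_prop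
  have h2 : Continuous fun p : Fin M → ℝ => p ⬝ᵥ L *ᵥ p := by
    simp only [dotProduct, Matrix.mulVec]; fun_prop
  have h3 : Continuous fun p : Fin M → ℝ => m ⬝ᵥ p := by
    simp only [dotProduct]; fun_prop
  have h4 : Continuous fun p : Fin M → ℝ => K *ᵥ p := by
    refine continuous_pi fun i => ?_
    simp only [dotProduct, Matrix.mulVec]; fun_prop
  have h5 : Continuous (gaussFactor L m) := by
    unfold gaussFactor; fun_prop
  exact (h5.comp h1).mul ((continuous_inner_weyl φ ψ).comp (h4.comp h1))

theorem norm_charForm_le (hL : L.PosDef) :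
    ∃ a > 0, ∀ (φ ψ : Hilb N) (v : EuclideanSpace ℝ (Fin M)),
      ‖charForm K L m φ ψ v‖ ≤ Real.exp (-a * ‖v‖ ^ 2) * (‖φ‖ * ‖ψ‖) := by
  obtain ⟨a, ha, h⟩ : ∃ a > 0, ∀ v : EuclideanSpace ℝ (Fin M),
      a * ‖v‖ ^ 2 ≤ v.ofLp ⬝ᵥ L *ᵥ v.ofLp := by
    have hc : Continuous fun v : EuclideanSpace ℝ (Fin M) => v.ofLp ⬝ᵥ L *ᵥ v.ofLp := by
      simp only [dotProduct, Matrix.mulVec]; fun_prop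
    rcases (Metric.sphere (0 : EuclideanSpace ℝ (Fin M)) 1).eq_empty_or_nonempty with he | hne
    · refine ⟨1, one_pos, fun v => ?_⟩
      rcases eq_or_ne v 0 with rfl | hv
      · simp
      · exact absurd (show ‖v‖⁻¹ • v ∈ Metric.sphere 0 1 by simp [norm_smul, hv]) (by simp [he])
    · obtain ⟨u, hu, hmin⟩ := (isCompact_sphere _ _).exists_isMinOn hne hc.continuousOn
      have hu0 : u.ofLp ≠ 0 := fun h0 => by
        have : u = 0 := by ext i; exact congrFun h0 i
        simp [this] at hu
      refine ⟨u.ofLp ⬝ᵥ L *ᵥ u.ofLp, by simpa using hL.dotProduct_mulVec_pos hu0, fun v => ?_⟩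
      rcases eq_or_ne v 0 with rfl | hv
      · simp
      · have h1 := hmin (show ‖v‖⁻¹ • v ∈ Metric.sphere 0 1 by simp [norm_smul, hv])
        simp only [Set.mem_ofPred_eq, WithLp.ofLp_smul, Matrix.mulVec_smul, dotProduct_smul,
          smul_dotProduct, smul_eq_mul] at h1
        have hv' : 0 < ‖v‖ := norm_pos_iff.2 hv
        have h2 := mul_le_mul_of_nonneg_right h1 (sq_nonneg ‖v‖)
        refine h2.trans_eq ?_
        field_simp
  -- `(2π)² / 4 = π²`
  refine ⟨Real.pi ^ 2 * a, by positivity, fun φ ψ v => ?_⟩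
  rw [charForm, norm_mul, norm_gaussFactor]
  have h1 : ‖inner ℂ φ (weyl (K *ᵥ ((2 * Real.pi) • v.ofLp)) ψ)‖ ≤ ‖φ‖ * ‖ψ‖ :=
    (norm_inner_le_norm _ _).trans_eq (by rw [norm_weyl])
  refine mul_le_mul (Real.exp_le_exp.2 ?_) h1 (norm_nonneg _) (Real.exp_pos _).le
  rw [Matrix.mulVec_smul, dotProduct_smul, smul_dotProduct, smul_eq_mul, smul_eq_mul]
  nlinarith [h v, mul_le_mul_of_nonneg_left (h v) (sq_nonneg Real.pi)]

theorem integrable_charForm (hL : L.PosDef) (φ ψ : Hilb N) : Integrable (charForm K L m φ ψ) := by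
  obtain ⟨a, ha, h⟩ := norm_charForm_le (K := K) (m := m) hL
  have h1 := (GaussianFourier.integrable_cexp_neg_mul_sq_norm_add
    (V := EuclideanSpace ℝ (Fin M)) (b := a) (by simpa) 0 0).norm.mul_const (‖φ‖ * ‖ψ‖)
  refine h1.mono' (continuous_charForm φ ψ).aestronglyMeasurable
    (Eventually.of_forall fun v => (h φ ψ v).trans_eq ?_)
  simp only [zero_mul, add_zero]
  rw [show -(a : ℂ) * (‖v‖ : ℂ) ^ 2 = ((-a * ‖v‖ ^ 2 : ℝ) : ℂ) by push_cast; ring,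
      Complex.norm_exp_ofReal]

/-- Existence of the Gaussian observable with parameters `(K, L, m)` for nonsingular `L`. Its
density is the Fourier transform of its characteristic function, which is integrable because `L`
is positive definite. -/
theorem exists_hasGaussianParams (m : Fin M → ℝ) (h : (noiseMatrix K L).PosSemidef)
    (hL : L.PosDef) : ∃ E : Observable M N, HasGaussianParams E K L m := by
  have hi := fun φ ψ : Hilb N => integrable_charForm (K := K) (m := m) hL φ ψ
  have hbd : ∀ (ψ : Hilb N) v, ‖charForm K L m ψ ψ v‖ ≤ ‖ψ‖ * ‖ψ‖ := by
    obtain ⟨a, ha, h⟩ := norm_charForm_le (N := N) (K := K) (m := m) hL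
    refine fun ψ v => (h ψ ψ v).trans (mul_le_of_le_one_left (by positivity) ?_)
    exact Real.exp_le_one_iff.2 (by nlinarith [mul_nonneg ha.le (sq_nonneg ‖v‖)])
  have hadd : ∀ f g : EuclideanSpace ℝ (Fin M) → ℂ, Integrable f → Integrable g →
      𝓕 (f + g) = 𝓕 f + 𝓕 g := fun f g hf hg =>
    (VectorFourier.fourierIntegral_add Real.continuous_fourierChar continuous_inner hf hg)
  have hsmul : ∀ (c : ℂ) (f : EuclideanSpace ℝ (Fin M) → ℂ), 𝓕 (c • f) = c • 𝓕 f := fun c f =>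
    VectorFourier.fourierIntegral_const_smul _ _ _ f c
  let d : Hilb N →ₗ⋆[ℂ] Hilb N →ₗ[ℂ] (EuclideanSpace ℝ (Fin M) → ℂ) :=
    LinearMap.mk₂'ₛₗ (starRingEnd ℂ) (RingHom.id ℂ) (fun φ ψ => 𝓕 (charForm K L m φ ψ))
    (fun φ φ' ψ => by
      rw [← hadd _ _ (hi _ _) (hi _ _)]
      congr 1
      ext v
      simp [charForm, inner_add_left, mul_add])
    (fun c φ ψ => by
      rw [← hsmul]
      congr 1
      ext v
      simp [charForm, inner_smul_left, mul_left_comm])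
    (fun φ ψ ψ' => by
      rw [← hadd _ _ (hi _ _) (hi _ _)]
      congr 1
      ext v
      simp [charForm, inner_add_right, mul_add])
    (fun c φ ψ => by
      rw [RingHom.id_apply, ← hsmul]
      congr 1
      ext v
      simp [charForm, inner_smul_right, mul_left_comm])
  have hinv : ∀ (ψ : Hilb N) v, ∫ w, Real.fourierChar ⟪w, v⟫ • d ψ ψ w = charForm K L m ψ ψ v :=
    fun ψ => integral_fourierChar_smul_fourier (posSemidef_charForm h ψ) (continuous_charForm ψ ψ)
      (hi ψ ψ) (hbd ψ)
  obtain ⟨E, hE⟩ := exists_povm_of_density d (ν := volume)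
    (fun ψ => integrable_fourier_of_posDef (posSemidef_charForm h ψ) (continuous_charForm ψ ψ)
      (hi ψ ψ) (hbd ψ))
    (fun ψ x => fourier_nonneg_of_posDef (posSemidef_charForm h ψ) (continuous_charForm ψ ψ)
      (hi ψ ψ) (hbd ψ) x)
    (fun ψ => by
      have := hinv ψ 0
      simpa [charForm, gaussFactor, weyl_zero] using this)
  refine ⟨E, h, fun p ψ => ?_⟩
  have hchar : ∀ x, ‖character p x‖ ≤ 1 := fun x => by
    rw [character, mul_comm, Complex.norm_exp_ofReal_mul_I]
  obtain ⟨h1, h2⟩ := hE ψ (character p) (by unfold character; fun_prop) 1 hchar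
  refine ⟨h1, ?_⟩
  rw [h2]
  have h3 := hinv ψ (WithLp.toLp 2 ((2 * Real.pi)⁻¹ • p))
  have h4 : (2 * Real.pi) • (2 * Real.pi)⁻¹ • p = p := by
    rw [smul_smul, mul_inv_cancel₀ Real.two_pi_pos.ne', one_smul]
  rw [charForm] at h3
  simp only [h4] at h3
  rw [_root_.smul_apply, inner_smul_right, ← h3]
  refine integral_congr_ae (Eventually.of_forall fun x => ?_)
  dsimp only
  rw [Circle.smul_def, Real.fourierChar_apply, smul_eq_mul, character]
  congr 2
  rw [mul_comm Complex.I]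
  congr 2
  rw [PiLp.inner_apply, Finset.mul_sum]
  refine Finset.sum_congr rfl fun j _ => ?_
  simp
  field_simp

end GaussianObservables

/-! ### Integration with respect to observables, channels and postprocessings -/

section Integration

variable {Ω : Type*} [MeasurableSpace Ω] {H : Type*} [NormedAddCommGroup H]
  [InnerProductSpace ℂ H]

instance POVM.isFiniteMeasure_measure (E : POVM Ω H) (ψ : H) : IsFiniteMeasure (E.measure ψ) :=
  ⟨by rw [E.measure_apply ψ MeasurableSet.univ]; exact ENNReal.ofReal_lt_top⟩

theorem POVM.measureReal_eq_inner (E : POVM Ω H) (ψ : H) {X : Set Ω} (hX : MeasurableSet X) :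
    (((E.measure ψ).real X : ℝ) : ℂ) = inner ℂ ψ (E.effect X ψ) := by
  rw [measureReal_def, E.measure_apply ψ hX, ENNReal.toReal_ofReal (E.inner_eq_re hX ψ).2]
  exact (E.inner_eq_re hX ψ).1.symm

theorem POVM.measureReal_univ (E : POVM Ω H) (ψ : H) :
    (E.measure ψ).real Set.univ = ‖ψ‖ ^ 2 := by
  have h := E.measureReal_eq_inner ψ MeasurableSet.univ
  rw [E.effect_univ, one_apply_eq_self, inner_self_eq_norm_sq_to_K] at h
  exact Complex.ofReal_injective (h.trans (Complex.ofReal_pow _ _).symm)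

/-- The integral of a simple function with respect to a positive operator valued measure. -/
noncomputable def POVM.simpleIntegral (E : POVM Ω H) (s : SimpleFunc Ω ℂ) : H →L[ℂ] H :=
  ∑ c ∈ s.range, c • E.effect (s ⁻¹' {c})

theorem POVM.isIntegral_simpleFunc (E : POVM Ω H) (s : SimpleFunc Ω ℂ) :
    E.IsIntegral s (E.simpleIntegral s) := by
  intro ψ
  have hi : Integrable s (E.measure ψ) := s.integrable_of_isFiniteMeasure
  refine ⟨hi, ?_⟩
  rw [SimpleFunc.integral_eq_sum s hi, POVM.simpleIntegral, _root_.sum_apply, inner_sum]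
  refine Finset.sum_congr rfl fun c _ => ?_
  rw [_root_.smul_apply, inner_smul_right, ← E.measureReal_eq_inner ψ (s.measurableSet_fiber c),
    Complex.real_smul, mul_comm]

theorem tendsto_inner_of_tendsto_inner_self {u : ℕ → H →L[ℂ] H} {T : H →L[ℂ] H}
    (h : ∀ ψ, Tendsto (fun n => inner ℂ ψ (u n ψ)) atTop (𝓝 (inner ℂ ψ (T ψ)))) (φ ψ : H) :
    Tendsto (fun n => inner ℂ φ (u n ψ)) atTop (𝓝 (inner ℂ φ (T ψ))) := by
  have hs : ∀ S : H →L[ℂ] H, inner ℂ φ (S ψ) = sesqForm S φ ψ := fun S => rfl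
  have hs' : ∀ S : H →L[ℂ] H, ∀ χ, sesqForm S χ χ = inner ℂ χ (S χ) := fun S _ => rfl
  simp only [hs]
  rw [sesq_polarization (sesqForm T)]
  simp only [fun n => sesq_polarization (sesqForm (u n)) φ ψ, hs']
  exact ((((h _).sub (h _)).sub ((h _).const_smul _)).add ((h _).const_smul _)).const_smul _

/-- A channel maps the integral of a bounded function with respect to an observable to the
integral with respect to the image observable. For simple functions this is linearity; in general
it follows from normality. -/
theorem QuantumChannel.isIntegral_map {H' : Type*} [NormedAddCommGroup H']
    [InnerProductSpace ℂ H'] [CompleteSpace H'] [CompleteSpace H] (Λ : QuantumChannel H' H)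
    (E : POVM Ω H') {f : Ω → ℂ} (hf : Measurable f) {C : ℝ} (hC0 : 0 ≤ C)
    (hC : ∀ x, ‖f x‖ ≤ C) {T : H' →L[ℂ] H'} (hT : E.IsIntegral f T) : (Λ.map E).IsIntegral f (Λ.toCP T) := by
  intro ψ
  refine ⟨Integrable.of_bound hf.aestronglyMeasurable C (Eventually.of_forall hC), ?_⟩
  have hsm := hf.stronglyMeasurable
  let s := hsm.approxBounded C
  have hs : ∀ n x, ‖s n x‖ ≤ C := fun n x => hsm.norm_approxBounded_le hC0 n x
  have hlim : ∀ x, Tendsto (fun n => s n x) atTop (𝓝 (f x)) := fun x =>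
    hsm.tendsto_approxBounded_of_norm_le (hC x)
  have hdom : ∀ (μ : Measure Ω) [IsFiniteMeasure μ],
      Tendsto (fun n => ∫ x, s n x ∂μ) atTop (𝓝 (∫ x, f x ∂μ)) := fun μ _ =>
    tendsto_integral_of_dominated_convergence (fun _ => C)
      (fun n => (s n).stronglyMeasurable.aestronglyMeasurable) (integrable_const C)
      (fun n => Eventually.of_forall (hs n)) (Eventually.of_forall hlim)
  have hT' : Tendsto (fun n => E.simpleIntegral (s n)) atTop (@nhds _ (ultraweak H') T) := by
    refine tendsto_ultraweak_of_bounded (2 * C) (fun n => opNorm_le_of_inner_self_le hC0 fun χ => ?_)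
      (tendsto_inner_of_tendsto_inner_self fun χ => ?_)
    · rw [← (E.isIntegral_simpleFunc (s n) χ).2, ← E.measureReal_univ]
      exact norm_integral_le_of_norm_le_const (Eventually.of_forall (hs n))
    · have := hdom (E.measure χ)
      rw [(hT χ).2] at this
      simpa only [(E.isIntegral_simpleFunc (s _) χ).2] using this
  have h1 := tendsto_ultraweak.1
    ((@Continuous.tendsto _ _ (ultraweak H') (ultraweak H) _ Λ.normal _).comp hT')
    (SqSummablePair.single ψ ψ)
  have h2 : ∀ n, Λ.toCP (E.simpleIntegral (s n)) = (Λ.map E).simpleIntegral (s n) := fun n => by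
    simp only [POVM.simpleIntegral, map_sum, map_smul]
    rfl
  simp only [SqSummablePair.single_eval, Function.comp_apply, h2] at h1
  refine tendsto_nhds_unique (hdom _) ?_
  simpa only [((Λ.map E).isIntegral_simpleFunc (s _) ψ).2] using h1

/-- Postprocessing is composition of the outcome distributions with the kernel, in every state. -/
theorem isPostprocessing_iff {Ω' : Type*} [MeasurableSpace Ω'] (f : Kernel Ω Ω') [IsMarkovKernel f]
    (G : POVM Ω H) (E : POVM Ω' H) :
    IsPostprocessing f G E ↔ ∀ ψ, E.measure ψ = (G.measure ψ).bind f := by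
  have hi : ∀ ψ, ∀ X, MeasurableSet X → Integrable (fun x => (f x).real X) (G.measure ψ) :=
    fun ψ X hX => Integrable.of_bound (f.measurable_coe hX).ennreal_toReal.aestronglyMeasurable 1
      (Eventually.of_forall fun x => by
        rw [Real.norm_of_nonneg measureReal_nonneg]; exact measureReal_le_one)
  have hb : ∀ ψ, ∀ X, MeasurableSet X → (G.measure ψ).bind f X
      = ENNReal.ofReal (∫ x, (f x).real X ∂(G.measure ψ)) := by
    intro ψ X hX
    rw [Measure.bind_apply hX f.aemeasurable, ofReal_integral_eq_lintegral_ofReal (hi ψ X hX)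
      (Eventually.of_forall fun x => measureReal_nonneg)]
    simp
  have h0 : ∀ ψ, ∀ X, 0 ≤ ∫ x, (f x).real X ∂(G.measure ψ) := fun ψ X =>
    integral_nonneg fun x => measureReal_nonneg
  constructor
  · intro h ψ
    ext X hX
    rw [hb ψ X hX, E.measure_apply ψ hX, ← (h X hX ψ).2, integral_complex_ofReal, Complex.ofReal_re]
  · intro h X hX ψ
    refine ⟨(hi ψ X hX).ofReal, ?_⟩
    rw [integral_complex_ofReal, ← E.measureReal_eq_inner ψ hX, h, measureReal_def, hb ψ X hX,
      ENNReal.toReal_ofReal (h0 ψ X)]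

theorem integral_bind_kernel {Ω' : Type*} [MeasurableSpace Ω'] (f : Kernel Ω Ω') [IsMarkovKernel f]
    (μ : Measure Ω) [IsFiniteMeasure μ] {g : Ω' → ℂ} (hg : Measurable g) {C : ℝ}
    (hC : ∀ x, ‖g x‖ ≤ C) : ∫ y, g y ∂(μ.bind f) = ∫ x, ∫ y, g y ∂(f x) ∂μ := by
  have h := Kernel.integral_comp (η := f) (κ := Kernel.const Unit μ) (a := ()) (f := g)
    (Integrable.of_bound hg.aestronglyMeasurable C (Eventually.of_forall hC))
  simpa [Kernel.comp_apply] using h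

end Integration

/-! ### Gaussian postprocessings and the compatibility criterion -/

section Criterion

open scoped RealInnerProductSpace

variable {M N : ℕ}

theorem norm_character (p : Fin M → ℝ) (x : EuclideanSpace ℝ (Fin M)) : ‖character p x‖ = 1 := by
  rw [character, mul_comm, Complex.norm_exp_ofReal_mul_I]

theorem measurable_character (p : Fin M → ℝ) : Measurable (character p) := by
  unfold character
  fun_prop

theorem charFun_eq_integral_character (μ : Measure (EuclideanSpace ℝ (Fin M)))
    (t : EuclideanSpace ℝ (Fin M)) : charFun μ t = ∫ x, character t.ofLp x ∂μ := by
  rw [charFun_apply]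
  refine integral_congr_ae (Eventually.of_forall fun x => ?_)
  simp only [character, PiLp.inner_apply]
  rw [mul_comm]
  simp

/-- The quadratic form of `L - i KᵀΩK` at a complex vector with real part `p` and imaginary
part `q`. -/
theorem star_dotProduct_noiseMatrix_mulVec {ι : Type*} [Fintype ι] {K : Matrix (PhaseIdx N) ι ℝ}
    {L : Matrix ι ι ℝ} (hL : Lᵀ = L) (p q : ι → ℝ) :
    star (fun i => (p i : ℂ) + Complex.I * q i) ⬝ᵥ
        noiseMatrix K L *ᵥ (fun i => (p i : ℂ) + Complex.I * q i)
      = ((p ⬝ᵥ L *ᵥ p + q ⬝ᵥ L *ᵥ q + 2 * (K *ᵥ p ⬝ᵥ symplectic N *ᵥ (K *ᵥ q)) : ℝ) : ℂ) := by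
  have h1 : (fun i => (p i : ℂ) + Complex.I * q i)
      = (fun i => (p i : ℂ)) + Complex.I • fun i => (q i : ℂ) := rfl
  have h2 : star (fun i => (p i : ℂ) + Complex.I * q i)
      = (fun i => (p i : ℂ)) - Complex.I • fun i => (q i : ℂ) := by
    ext i
    simp [sub_eq_add_neg]
  have hqp : q ⬝ᵥ L *ᵥ p = p ⬝ᵥ L *ᵥ q := by
    rw [Matrix.dotProduct_mulVec, ← Matrix.mulVec_transpose, hL, dotProduct_comm]
  rw [h2, h1]
  simp only [Matrix.mulVec_add, Matrix.mulVec_smul, dotProduct_add, dotProduct_smul,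
    sub_dotProduct, smul_dotProduct, dotProduct_noiseMatrix_mulVec, dotProduct_symplectic_self,
    smul_eq_mul, dotProduct_symplectic_swap (K *ᵥ p) (K *ᵥ q), hqp]
  push_cast
  linear_combination (-(2 : ℂ) * ((K *ᵥ p ⬝ᵥ symplectic N *ᵥ (K *ᵥ q) : ℝ) : ℂ)
    - ((q ⬝ᵥ L *ᵥ q : ℝ) : ℂ)) * Complex.I_sq

theorem transpose_symplectic (N : ℕ) : (symplectic N)ᵀ = -symplectic N := by
  rw [symplectic, Matrix.blockDiagonal_transpose, ← Matrix.blockDiagonal_neg]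
  congr 1
  ext k i j
  fin_cases i <;> fin_cases j <;> simp

theorem isHermitian_noiseMatrix {ι : Type*} (K : Matrix (PhaseIdx N) ι ℝ)
    {L : Matrix ι ι ℝ} (hL : Lᵀ = L) : (noiseMatrix K L).IsHermitian := by
  have h : (Kᵀ * symplectic N * K)ᵀ = -(Kᵀ * symplectic N * K) := by
    rw [Matrix.transpose_mul, Matrix.transpose_mul, Matrix.transpose_transpose,
      transpose_symplectic, Matrix.neg_mul, Matrix.mul_neg, Matrix.mul_assoc]
  ext i j
  have h1 : L j i = L i j := congrFun (congrFun hL i) j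
  have h2 : (Kᵀ * symplectic N * K) j i = -(Kᵀ * symplectic N * K) i j :=
    congrFun (congrFun h i) j
  simp [noiseMatrix, h1, h2, sub_eq_add_neg]

/-- The matrix inequality `L - i KᵀΩK ≥ 0` as an uncertainty relation between real vectors. -/
theorem posSemidef_noiseMatrix_iff {ι : Type*} [Fintype ι] {K : Matrix (PhaseIdx N) ι ℝ}
    {L : Matrix ι ι ℝ} (hL : Lᵀ = L) : (noiseMatrix K L).PosSemidef ↔
      ∀ p q : ι → ℝ,
        0 ≤ p ⬝ᵥ L *ᵥ p + q ⬝ᵥ L *ᵥ q + 2 * (K *ᵥ p ⬝ᵥ symplectic N *ᵥ (K *ᵥ q)) := by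
  rw [Matrix.posSemidef_iff_dotProduct_mulVec]
  constructor
  · intro h p q
    have := h.2 fun i => (p i : ℂ) + Complex.I * q i
    rwa [star_dotProduct_noiseMatrix_mulVec hL, Complex.zero_le_real] at this
  · refine fun h => ⟨isHermitian_noiseMatrix K hL, fun z => ?_⟩
    have hz : z = fun i => ((z i).re : ℂ) + Complex.I * (z i).im := by
      ext i
      rw [mul_comm, Complex.re_add_im]
    rw [hz, star_dotProduct_noiseMatrix_mulVec hL, Complex.zero_le_real]
    exact h _ _

theorem posSemidef_of_posSemidef_noiseMatrix {ι : Type*} [Fintype ι] {K : Matrix (PhaseIdx N) ι ℝ}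
    {L : Matrix ι ι ℝ} (h : (noiseMatrix K L).PosSemidef) : L.PosSemidef := by
  have hL := transpose_eq_of_posSemidef_noiseMatrix h
  refine Matrix.posSemidef_iff_dotProduct_mulVec.2 ⟨?_, fun p => ?_⟩
  · rw [Matrix.IsHermitian, Matrix.conjTranspose_eq_transpose_of_trivial, hL]
  · have := (posSemidef_noiseMatrix_iff hL).1 h p 0
    simpa using this

/-- Existence of Gaussian postprocessings with given parameters: independent Gaussian noise is
added to the affine image `Aᵀx - c` of the input. -/
theorem exists_gaussianKernel {M' : ℕ} (A : Matrix (Fin M) (Fin M') ℝ)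
    {B : Matrix (Fin M') (Fin M') ℝ} (hB : B.PosSemidef) (c : Fin M' → ℝ) :
    ∃ f : Kernel (EuclideanSpace ℝ (Fin M)) (EuclideanSpace ℝ (Fin M')), IsMarkovKernel f ∧
      ∀ (p : Fin M' → ℝ) (x : EuclideanSpace ℝ (Fin M)),
        ∫ y, character p y ∂(f x) = character (A *ᵥ p) x * gaussFactor B c p := by
  have hS : ((1 / 2 : ℝ) • B).PosSemidef := hB.smul (by norm_num)
  let g : EuclideanSpace ℝ (Fin M) → EuclideanSpace ℝ (Fin M') :=
    fun x => WithLp.toLp 2 (Aᵀ *ᵥ x.ofLp)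
  have hg : Measurable g := by
    refine Continuous.measurable ?_
    fun_prop
  let ν := multivariateGaussian (WithLp.toLp 2 (-c)) ((1 / 2 : ℝ) • B)
  refine ⟨((Kernel.deterministic g hg) ×ₖ (Kernel.const _ ν)).map fun z => z.1 + z.2,
    Kernel.IsMarkovKernel.map _ (by fun_prop), fun p x => ?_⟩
  rw [Kernel.map_apply _ (by fun_prop), Kernel.prod_apply, Kernel.const_apply,
    Kernel.deterministic_apply]
  change ∫ y, character p y ∂((Measure.dirac (g x)) ∗ ν) = _
  rw [show p = (WithLp.toLp 2 p).ofLp from rfl, ← charFun_eq_integral_character, charFun_conv,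
    charFun_dirac, charFun_multivariateGaussian hS, character, gaussFactor, ← Complex.exp_add,
    ← Complex.exp_add]
  congr 1
  have h1 : ⟪g x, WithLp.toLp 2 p⟫ = ∑ j, (A *ᵥ p) j * x j := by
    change _ = (A *ᵥ p) ⬝ᵥ x.ofLp
    rw [EuclideanSpace.inner_eq_star_dotProduct]
    simp only [g, star_trivial]
    rw [Matrix.dotProduct_mulVec, Matrix.vecMul_transpose]
  have h2 : ⟪WithLp.toLp 2 p, WithLp.toLp 2 (-c)⟫ = -(c ⬝ᵥ p) := by
    rw [EuclideanSpace.inner_toLp_toLp]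
    simp
  rw [h1, h2, Matrix.smul_mulVec, dotProduct_smul, smul_eq_mul]
  push_cast
  ring

variable {N' M₀ : ℕ} {Λ : QuantumChannel (Hilb N') (Hilb N)}
  {A : Matrix (PhaseIdx N) (PhaseIdx N') ℝ} {B : Matrix (PhaseIdx N') (PhaseIdx N') ℝ}
  {c : PhaseIdx N' → ℝ}

theorem integral_character_map (hΛ : IsGaussianChannel Λ A B c) {E : Observable M N'}
    {K : Matrix (PhaseIdx N') (Fin M) ℝ} {L : Matrix (Fin M) (Fin M) ℝ} {m : Fin M → ℝ}
    (hE : HasGaussianParams E K L m) (p : Fin M → ℝ) (ψ : Hilb N) :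
    ∫ x, character p x ∂((Λ.map E).measure ψ) =
      gaussFactor L m p * gaussFactor B c (K *ᵥ p) * inner ℂ ψ (weyl (A *ᵥ (K *ᵥ p)) ψ) := by
  rw [(Λ.isIntegral_map E (measurable_character p) zero_le_one (fun x => (norm_character p x).le)
    (hE.2 p) ψ).2, map_smul, hΛ.2, smul_smul, _root_.smul_apply, inner_smul_right]

theorem integral_character_bind {G : Observable M₀ N} {K₀ : Matrix (PhaseIdx N) (Fin M₀) ℝ}
    {L₀ : Matrix (Fin M₀) (Fin M₀) ℝ} {m₀ : Fin M₀ → ℝ} (hG : HasGaussianParams G K₀ L₀ m₀)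
    {f : Kernel (EuclideanSpace ℝ (Fin M₀)) (EuclideanSpace ℝ (Fin M))} [IsMarkovKernel f]
    {a : Matrix (Fin M₀) (Fin M) ℝ} {b : Matrix (Fin M) (Fin M) ℝ} {d : Fin M → ℝ}
    (hf : ∀ p x, ∫ y, character p y ∂(f x) = character (a *ᵥ p) x * gaussFactor b d p)
    (p : Fin M → ℝ) (ψ : Hilb N) :
    ∫ x, character p x ∂((G.measure ψ).bind f) =
      gaussFactor b d p * gaussFactor L₀ m₀ (a *ᵥ p) *
        inner ℂ ψ (weyl (K₀ *ᵥ (a *ᵥ p)) ψ) := by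
  rw [integral_bind_kernel f _ (measurable_character p) (fun x => (norm_character p x).le)]
  simp only [hf]
  rw [integral_mul_const, (hG.2 (a *ᵥ p) ψ).2, _root_.smul_apply, inner_smul_right]
  ring

/-- Comparison of characteristic functions: if the image of a Gaussian observable is a Gaussian
postprocessing of `G`, then its noise is at least the noise of `G` in the direction that is
measured. -/
theorem exists_le_of_isPostprocessing (hΛ : IsGaussianChannel Λ A B c) {E : Observable M N'}
    {K : Matrix (PhaseIdx N') (Fin M) ℝ} {L : Matrix (Fin M) (Fin M) ℝ} {m : Fin M → ℝ}
    (hE : HasGaussianParams E K L m) {G : Observable M₀ N} {K₀ : Matrix (PhaseIdx N) (Fin M₀) ℝ}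
    {L₀ : Matrix (Fin M₀) (Fin M₀) ℝ} {m₀ : Fin M₀ → ℝ} (hG : HasGaussianParams G K₀ L₀ m₀)
    {f : Kernel (EuclideanSpace ℝ (Fin M₀)) (EuclideanSpace ℝ (Fin M))} (hf : IsGaussianKernel f)
    (hp : IsPostprocessing f G (Λ.map E)) (p : Fin M → ℝ) :
    ∃ s : Fin M₀ → ℝ, A *ᵥ (K *ᵥ p) = K₀ *ᵥ s ∧
      s ⬝ᵥ L₀ *ᵥ s ≤ p ⬝ᵥ L *ᵥ p + K *ᵥ p ⬝ᵥ B *ᵥ (K *ᵥ p) := by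
  obtain ⟨hM, a, b, d, hb, hf⟩ := hf
  have hμ := (isPostprocessing_iff f G (Λ.map E)).1 hp
  have h1 : (gaussFactor L m p * gaussFactor B c (K *ᵥ p)) • weyl (A *ᵥ (K *ᵥ p))
      = (gaussFactor b d p * gaussFactor L₀ m₀ (a *ᵥ p)) • weyl (N := N) (K₀ *ᵥ (a *ᵥ p)) := by
    refine ContinuousLinearMap.coe_injective ((ext_inner_map _ _).1 fun ψ => ?_)
    have h2 := integral_character_map hΛ hE p ψ
    rw [hμ, integral_character_bind hG hf] at h2
    have h3 := congrArg (starRingEnd ℂ) h2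
    simpa [inner_smul_left] using h3.symm
  have hne : gaussFactor L m p * gaussFactor B c (K *ᵥ p) ≠ 0 :=
    mul_ne_zero (Complex.exp_ne_zero _) (Complex.exp_ne_zero _)
  have hA := eq_of_smul_weyl_eq_smul_weyl hne h1
  refine ⟨a *ᵥ p, hA, ?_⟩
  obtain ⟨ψ, hψ⟩ := exists_ne_zero_hilb N
  have h4 := congrArg (fun T : Hilb N →L[ℂ] Hilb N => ‖T ψ‖) h1
  simp only [_root_.smul_apply, norm_smul, norm_weyl, norm_mul, norm_gaussFactor,
    ← Real.exp_add] at h4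
  have h5 := Real.exp_injective (mul_right_cancel₀ (norm_ne_zero_iff.2 hψ) h4)
  have h6 : 0 ≤ p ⬝ᵥ b *ᵥ p := by simpa using hb.dotProduct_mulVec_nonneg p
  linarith

/-- A real null vector `u` of `B` annihilates the quadratic forms of `B - i AᵀΩA` and of
`B + iΩ - i AᵀΩA`, hence lies in the kernels of both matrices and in that of `Ω`. -/
theorem posDef_of_posSemidef_noiseMatrix
    (h : (noiseMatrix A B + Complex.I • (symplectic N').map Complex.ofReal).PosSemidef)
    (h' : (noiseMatrix A B).PosSemidef) : B.PosDef := by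
  have hB := posSemidef_of_posSemidef_noiseMatrix h'
  refine Matrix.posDef_iff_dotProduct_mulVec.2 ⟨hB.1, fun u hu => ?_⟩
  refine lt_of_le_of_ne (hB.dotProduct_mulVec_nonneg u) fun h0 => hu ?_
  rw [star_trivial] at h0
  let z : PhaseIdx N' → ℂ := fun i => u i
  have hz : star z = z := by ext i; simp [z]
  have h1 : star z ⬝ᵥ noiseMatrix A B *ᵥ z = 0 := by
    rw [hz, dotProduct_noiseMatrix_mulVec, ← h0, dotProduct_symplectic_self]
    simp
  have hΩ : ∀ w : PhaseIdx N' → ℝ, (symplectic N').map Complex.ofReal *ᵥ (fun i => (w i : ℂ))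
      = fun i => ((symplectic N' *ᵥ w) i : ℂ) := fun w => by
    ext i
    simp [Matrix.mulVec, dotProduct]
  have h2 : star z ⬝ᵥ (symplectic N').map Complex.ofReal *ᵥ z = 0 := by
    rw [hz, hΩ]
    have := congrArg Complex.ofReal (dotProduct_symplectic_self u)
    simpa [dotProduct, z] using this
  have h3 : (noiseMatrix A B + Complex.I • (symplectic N').map Complex.ofReal) *ᵥ z = 0 := by
    rw [← h.dotProduct_mulVec_zero_iff, Matrix.add_mulVec, dotProduct_add, h1, Matrix.smul_mulVec,
      dotProduct_smul, h2]
    simp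
  rw [Matrix.add_mulVec, (h'.dotProduct_mulVec_zero_iff z).1 h1, zero_add, Matrix.smul_mulVec,
    smul_eq_zero_iff_right Complex.I_ne_zero, hΩ] at h3
  have h4 : symplectic N' *ᵥ u = 0 := by
    ext i
    exact Complex.ofReal_injective (congrFun h3 i)
  have h5 : ∀ w, w ⬝ᵥ symplectic N' *ᵥ u = 0 := fun w => by rw [h4, dotProduct_zero]
  ext ⟨i, j⟩
  have e0 := h5 (Pi.single (0, j) 1)
  have e1 := h5 (Pi.single (1, j) 1)
  rw [dotProduct_symplectic_mulVec] at e0 e1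
  simp [Pi.single_apply] at e0 e1
  fin_cases i
  · simpa using e1
  · simpa using e0

theorem posSemidef_of_isGaussianIncompatibilityBreaking (hΛ : IsGaussianChannel Λ A B c)
    (h : IsGaussianIncompatibilityBreaking Λ) : (noiseMatrix A B).PosSemidef := by
  obtain ⟨M₀, G, ⟨K₀, L₀, m₀, hG⟩, hcomp⟩ := h
  have hB : Bᵀ = B := by
    ext i j
    have h1 := congrArg Complex.re (congrFun (congrFun hΛ.1.1 i) j)
    simpa [noiseMatrix, Matrix.conjTranspose_apply] using h1
  -- the quadrature in direction `u`, blurred by noise of size `ε` to make it absolutely continuous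
  have key : ∀ (u : PhaseIdx N' → ℝ) (ε : ℝ), 0 < ε → ∃ s : Fin M₀ → ℝ, A *ᵥ u = K₀ *ᵥ s ∧
      s ⬝ᵥ L₀ *ᵥ s ≤ ε + u ⬝ᵥ B *ᵥ u := by
    intro u ε hε
    let K : Matrix (PhaseIdx N') (Fin 1) ℝ := Matrix.of fun i _ => u i
    have hK : ∀ p : Fin 1 → ℝ, K *ᵥ p = p 0 • u := fun p => by
      ext i
      simp [K, Matrix.mulVec, dotProduct, mul_comm]
    have hL : (ε • (1 : Matrix (Fin 1) (Fin 1) ℝ)).PosDef := Matrix.PosDef.one.smul hε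
    have hn : (noiseMatrix K (ε • 1)).PosSemidef := by
      rw [posSemidef_noiseMatrix_iff (by simp)]
      intro p q
      simp only [hK, Matrix.mulVec_smul, dotProduct_smul, smul_dotProduct,
        dotProduct_symplectic_self, smul_zero, mul_zero, add_zero]
      have := hL.posSemidef.dotProduct_mulVec_nonneg
      exact add_nonneg (this p) (this q)
    obtain ⟨E, hE⟩ := exists_hasGaussianParams 0 hn hL
    obtain ⟨f, hf, hp⟩ := hcomp ⟨1, Λ.map E⟩ ⟨⟨1, E⟩, ⟨K, _, 0, hE⟩, rfl⟩
    obtain ⟨s, hs1, hs2⟩ := exists_le_of_isPostprocessing hΛ hE hG hf hp 1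
    have hK1 : K *ᵥ 1 = u := by simp [hK]
    rw [hK1] at hs1 hs2
    refine ⟨s, hs1, hs2.trans_eq ?_⟩
    simp [Matrix.smul_mulVec]
  rw [posSemidef_noiseMatrix_iff hB]
  intro p q
  refine le_of_forall_pos_le_add fun ε hε => ?_
  obtain ⟨s, hs1, hs2⟩ := key p (ε / 2) (by positivity)
  obtain ⟨t, ht1, ht2⟩ := key q (ε / 2) (by positivity)
  have h1 := (posSemidef_noiseMatrix_iff (transpose_eq_of_posSemidef_noiseMatrix hG.1)).1 hG.1 s t
  rw [← hs1, ← ht1] at h1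
  linarith

theorem isGaussianIncompatibilityBreaking_of_posSemidef (hΛ : IsGaussianChannel Λ A B c)
    (h : (noiseMatrix A B).PosSemidef) : IsGaussianIncompatibilityBreaking Λ := by
  let e := Fintype.equivFin (PhaseIdx N')
  have hB : (B.submatrix e.symm e.symm).PosDef :=
    (posDef_of_posSemidef_noiseMatrix hΛ.1 h).submatrix e.symm.injective
  have hn : (noiseMatrix (A.submatrix id e.symm) (B.submatrix e.symm e.symm)).PosSemidef :=
    h.submatrix e.symm
  obtain ⟨G, hG⟩ := exists_hasGaussianParams (c ∘ e.symm) hn hB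
  refine ⟨_, G, ⟨_, _, _, hG⟩, ?_⟩
  rintro _ ⟨⟨M, E⟩, ⟨K, L, m, hE⟩, rfl⟩
  have hL := posSemidef_of_posSemidef_noiseMatrix hE.1
  obtain ⟨f, hM, hf⟩ := exists_gaussianKernel (K.submatrix e.symm id) hL m
  refine ⟨f, ⟨hM, _, _, _, hL, hf⟩, (isPostprocessing_iff _ _ _).2 fun ψ => ?_⟩
  refine Measure.ext_of_charFun (funext fun t => ?_)
  rw [charFun_eq_integral_character, charFun_eq_integral_character, integral_character_map hΛ hE,
    integral_character_bind hG hf]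
  have h1 : (K.submatrix e.symm id) *ᵥ t.ofLp = (K *ᵥ t.ofLp) ∘ e.symm := rfl
  have h2 : ∀ {ι : Type} (X : Matrix ι (PhaseIdx N') ℝ) (w : PhaseIdx N' → ℝ),
      X.submatrix id e.symm *ᵥ (w ∘ e.symm) = X *ᵥ w := fun X w => by
    ext i
    exact e.symm.sum_comp fun j => X i j * w j
  have h3 : gaussFactor (B.submatrix e.symm e.symm) (c ∘ e.symm) ((K *ᵥ t.ofLp) ∘ e.symm)
      = gaussFactor B c (K *ᵥ t.ofLp) := by
    have h4 : ∀ v w : PhaseIdx N' → ℝ, (v ∘ e.symm) ⬝ᵥ (w ∘ e.symm) = v ⬝ᵥ w := fun v w =>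
      e.symm.sum_comp fun j => v j * w j
    have h5 : B.submatrix e.symm e.symm *ᵥ ((K *ᵥ t.ofLp) ∘ e.symm)
        = (B *ᵥ (K *ᵥ t.ofLp)) ∘ e.symm := by
      rw [← h2 B]
      rfl
    rw [gaussFactor, gaussFactor, h5, h4, h4]
  rw [h1, h2, h3]

end Criterion

end GaussianIB

theorem mainTheorem1 (N' N : ℕ)
    (Λ : GaussianIB.QuantumChannel (GaussianIB.Hilb N') (GaussianIB.Hilb N))
    (A : Matrix (GaussianIB.PhaseIdx N) (GaussianIB.PhaseIdx N') ℝ)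
    (B : Matrix (GaussianIB.PhaseIdx N') (GaussianIB.PhaseIdx N') ℝ)
    (c : GaussianIB.PhaseIdx N' → ℝ)
    (hΛ : GaussianIB.IsGaussianChannel Λ A B c) :
    GaussianIB.IsGaussianIncompatibilityBreaking Λ ↔
      (B.map Complex.ofReal -
        Complex.I • (Aᵀ * GaussianIB.symplectic N * A).map Complex.ofReal).PosSemidef := by
  exact ⟨GaussianIB.posSemidef_of_isGaussianIncompatibilityBreaking hΛ,
    GaussianIB.isGaussianIncompatibilityBreaking_of_posSemidef hΛ⟩
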